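/- Let $\mathcal L_{\mathrm{tr}}$ be the language (in continuous logic with domains of quantification) of tracial $\mathrm W^*$-algebras: one sort, domains $D_r$ ($r>0$), a metric symbol $d$, function symbols $+,\cdot,*$, scalar multiplications, $0$, $1$, and a symbol $t_p$ for every non-commutative $*$-polynomial $p$, and relation symbols $\operatorname{Re}\operatorname{tr}$, $\operatorname{Im}\operatorname{tr}$. A tracial $\mathrm W^*$-algebra $(M,\tau)$ (a $\mathrm W^*$-algebra with a faithful weak-$*$ continuous tracial state) is regarded as an $\mathcal L_{\mathrm{tr}}$-structure in which $D_r$ is the operator-norm ball of radius $r$ and $d(x,y)=\|x-y\|_2=\tau((x-y)^*(x-y))^{1/2}$. Let $\mathrm T_{\mathrm{tr}}$ be the theory of tracial $\mathrm W^*$-algebras, i.e. the set of all sentences that have the value $0$ in every tracial $\mathrm W^*$-algebra. The type $\operatorname{tp}^{\mathcal M}(\mathbf X)$ of a tuple $\mathbf X=(X_j)_{j\in\mathbb N}$ in a model $\mathcal M\models\mathrm T_{\mathrm{tr}}$ is the map $\phi\mapsto\phi^{\mathcal M}(\mathbf X)$ on all formulas in the variables $(x_j)_{j\in\mathbb N}$;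 its quantifier-free type (or non-commutative law) $\operatorname{tp}_{\mathrm{qf}}^{\mathcal M}(\mathbf X)$ is the restriction of this map to formulas without $\sup$ and $\inf$. Let $\mathbb S(\mathrm T_{\mathrm{tr}})$ and $\mathbb S_{\mathrm{qf}}(\mathrm T_{\mathrm{tr}})$ be the spaces of all types and of all quantifier-free types of $\mathbb N$-tuples in models of $\mathrm T_{\mathrm{tr}}$. For $\mathbf r\in(0,\infty)^{\mathbb N}$ let $\mathbb S_{\mathbf r}(\mathrm T_{\mathrm{tr}})$ and $\mathbb S_{\mathrm{qf},\mathbf r}(\mathrm T_{\mathrm{tr}})$ be the subsets of those realized by tuples in $\prod_j D_{r_j}^{\mathcal M}$, with the topology of pointwise convergence on formulas; a subset of $\mathbb S(\mathrm T_{\mathrm{tr}})$ (resp. $\mathbb S_{\mathrm{qf}}(\mathrm T_{\mathrm{tr}})$) is open if its intersection with each $\mathbb S_{\mathbf r}(\mathrm T_{\mathrm{tr}})$ (resp. $\mathbb S_{\mathrm{qf},\mathbf r}(\mathrm T_{\mathrm{tr}})$) is open there. Let $\pi_{\mathrm{qf}}:\mathbb S(\mathrm T_{\mathrm{tr}})\to\mathbb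 S_{\mathrm{qf}}(\mathrm T_{\mathrm{tr}})$ be the restriction map. Fix a non-principal ultrafilter $\mathcal U$ on $\mathbb N$. View $M_n(\mathbb C)$ as a tracial $\mathrm W^*$-algebra with the normalized trace. For $\Omega\subseteq M_n(\mathbb C)^{\mathbb N}$, a finite $F\subseteq\mathbb N$ and $\epsilon>0$, let $K^{\mathrm{orb}}_{F,\epsilon}(\Omega)$ be the least cardinality of a set $\Omega'\subseteq M_n(\mathbb C)^{\mathbb N}$ such that for every $\mathbf Y\in\Omega$ there are $\mathbf X\in\Omega'$ and a unitary $U\in M_n(\mathbb C)$ with $\|Y_i-UX_iU^*\|_2<\epsilon$ for all $i\in F$. For a set $\mathcal K$ of types, let $\Gamma^{(n)}_{\mathbf r}(\mathcal K)$ be the set of $\mathbf X\in M_n(\mathbb C)^{\mathbb N}$ with $\|X_j\|\le r_j$ for all $j$ and $\operatorname{tp}^{M_n(\mathbb C)}(\mathbf X)\in\mathcal K$, and define \[ \operatorname{Ent}^{\mathcal U}(\mathcal K)=\sup_{\mathbf r,F,\epsilon}\ \inf_{\mathcal O\supseteq\mathcal K\text{ open in }\mathbb S(\mathrm T_{\mathrm{tr}})}\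 \lim_{n\to\mathcal U}\frac1{n^2}\log K^{\mathrm{orb}}_{F,\epsilon}\bigl(\Gamma^{(n)}_{\mathbf r}(\mathcal O)\bigr)\in[-\infty,\infty], \] where $\log 0=-\infty$. For a set $\mathcal K$ of quantifier-free types, $\operatorname{Ent}^{\mathcal U}_{\mathrm{qf}}(\mathcal K)$ (the orbital form of Hayes' $1$-bounded entropy) is defined in the same way with $\operatorname{tp}_{\mathrm{qf}}$ and $\mathbb S_{\mathrm{qf}}(\mathrm T_{\mathrm{tr}})$ in place of $\operatorname{tp}$ and $\mathbb S(\mathrm T_{\mathrm{tr}})$. Write $\operatorname{Ent}^{\mathcal U}(\nu)=\operatorname{Ent}^{\mathcal U}(\{\nu\})$ and $\operatorname{Ent}^{\mathcal U}_{\mathrm{qf}}(\mu)=\operatorname{Ent}^{\mathcal U}_{\mathrm{qf}}(\{\mu\})$. Then: (1) for every quantifier-free type $\mu\in\mathbb S_{\mathrm{qf}}(\mathrm T_{\mathrm{tr}})$, \[ \operatorname{Ent}^{\mathcal U}_{\mathrm{qf}}(\mu)=\sup_{\nu\in\pi_{\mathrm{qf}}^{-1}(\mu)}\operatorname{Ent}^{\mathcal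 U}(\nu); \] (2) for every closed $\mathcal K\subseteq\mathbb S_{\mathrm{qf}}(\mathrm T_{\mathrm{tr}})$, \[ \operatorname{Ent}^{\mathcal U}_{\mathrm{qf}}(\mathcal K)=\operatorname{Ent}^{\mathcal U}(\pi_{\mathrm{qf}}^{-1}(\mathcal K)). \] -/

import Mathlib

open Filter Topology
open scoped Matrix.Norms.L2Operator

noncomputable section

/-! ### Continuous model theory (one sort, with domains of quantification) -/

/-- A modulus of continuity: a continuous, increasing, zero-preserving function
`[0,∞) → [0,∞)`. -/
structure ContinuityModulus where
  toFun : NNReal → NNReal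
  continuous' : Continuous toFun
  monotone' : Monotone toFun
  map_zero' : toFun 0 = 0

/-- The modulus `t ↦ C * t`. -/
def ContinuityModulus.linear (C : NNReal) : ContinuityModulus where
  toFun t := C * t
  continuous' := by fun_prop
  monotone' := fun _ _ h => mul_le_mul_of_nonneg_left h C.2
  map_zero' := mul_zero C

/-- A language of continuous logic with a single sort. The metric symbol is part of the logic
(see `Formula.dist`). -/
structure MetricLanguage where
  /-- domains of quantification -/
  Dom : Type
  /-- bound for the distance between elements of two domains -/
  diam : Dom → Dom → ℝ
  /-- function symbols of each arity, with their range bounds and moduli of continuity -/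
  Func : ℕ → Type
  funcRange : ∀ {n : ℕ}, Func n → (Fin n → Dom) → Dom
  funcModulus : ∀ {n : ℕ}, Func n → (Fin n → Dom) → Fin n → ContinuityModulus
  /-- relation symbols of each arity, with their bounds and moduli of continuity -/
  Rel : ℕ → Type
  relBound : ∀ {n : ℕ}, Rel n → (Fin n → Dom) → ℝ
  relModulus : ∀ {n : ℕ}, Rel n → (Fin n → Dom) → Fin n → ContinuityModulus

namespace MetricLanguage

/-- An interpretation of the symbols of `L`, not yet subject to the requirements on
`L`-structures, which are stated in `Interpretation.IsStructure`. -/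
structure Interpretation (L : MetricLanguage) where
  carrier : Type
  dist : carrier → carrier → ℝ
  dom : L.Dom → Set carrier
  func : ∀ {n : ℕ}, L.Func n → (Fin n → carrier) → carrier
  rel : ∀ {n : ℕ}, L.Rel n → (Fin n → carrier) → ℝ

/-- The requirements for an interpretation of the symbols of `L` to be an `L`-structure. -/
structure Interpretation.IsStructure {L : MetricLanguage} (M : L.Interpretation) : Prop where
  dist_eq_zero : ∀ a b, M.dist a b = 0 ↔ a = b
  dist_comm : ∀ a b, M.dist a b = M.dist b a
  dist_triangle : ∀ a b c, M.dist a c ≤ M.dist a b + M.dist b c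
  /-- every domain of quantification is complete -/
  dom_complete : ∀ (D : L.Dom) (u : ℕ → M.carrier), (∀ k, u k ∈ M.dom D) →
    (∀ ε > 0, ∃ N, ∀ k ≥ N, ∀ l ≥ N, M.dist (u k) (u l) < ε) →
    ∃ a ∈ M.dom D, ∀ ε > 0, ∃ N, ∀ k ≥ N, M.dist (u k) a < ε
  dom_cover : ∀ a, ∃ D, a ∈ M.dom D
  dist_le : ∀ (D D' : L.Dom), ∀ a ∈ M.dom D, ∀ b ∈ M.dom D', M.dist a b ≤ L.diam D D'
  func_mem : ∀ {n : ℕ} (f : L.Func n) (D : Fin n → L.Dom) (a : Fin n → M.carrier),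
    (∀ i, a i ∈ M.dom (D i)) → M.func f a ∈ M.dom (L.funcRange f D)
  func_modulus : ∀ {n : ℕ} (f : L.Func n) (D : Fin n → L.Dom) (a : Fin n → M.carrier) (i : Fin n)
    (b : M.carrier), (∀ j, a j ∈ M.dom (D j)) → b ∈ M.dom (D i) →
    M.dist (M.func f a) (M.func f (Function.update a i b)) ≤
      (L.funcModulus f D i).toFun (M.dist (a i) b).toNNReal
  rel_le : ∀ {n : ℕ} (R : L.Rel n) (D : Fin n → L.Dom) (a : Fin n → M.carrier),
    (∀ i, a i ∈ M.dom (D i)) → |M.rel R a| ≤ L.relBound R D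
  rel_modulus : ∀ {n : ℕ} (R : L.Rel n) (D : Fin n → L.Dom) (a : Fin n → M.carrier) (i : Fin n)
    (b : M.carrier), (∀ j, a j ∈ M.dom (D j)) → b ∈ M.dom (D i) →
    |M.rel R a - M.rel R (Function.update a i b)| ≤
      (L.relModulus R D i).toFun (M.dist (a i) b).toNNReal

/-- Terms in the variables `x₀, x₁, …`. -/
inductive Term (L : MetricLanguage) : Type
  | var : ℕ → Term L
  | func : ∀ {n : ℕ}, L.Func n → (Fin n → Term L) → Term L

/-- Formulas in the variables `x₀, x₁, …`: basic formulas, continuous combinations of finitely many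
formulas, and suprema and infima of a formula over a variable ranging in a domain. -/
inductive Formula (L : MetricLanguage) : Type
  | dist : L.Term → L.Term → Formula L
  | rel : ∀ {n : ℕ}, L.Rel n → (Fin n → L.Term) → Formula L
  | conn : ∀ {n : ℕ}, C(Fin n → ℝ, ℝ) → (Fin n → Formula L) → Formula L
  | sup : L.Dom → ℕ → Formula L → Formula L
  | inf : L.Dom → ℕ → Formula L → Formula L

variable {L : MetricLanguage}

/-- The interpretation of a term. -/
def Term.eval (M : L.Interpretation) (v : ℕ → M.carrier) : L.Term → M.carrier
  | .var k => v k
  | .func f t => M.func f fun i => (t i).eval M v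

/-- The interpretation `φ^M(v)` of a formula, where `v k` is the value of the variable `x_k`. -/
def Formula.eval (M : L.Interpretation) : L.Formula → (ℕ → M.carrier) → ℝ
  | .dist s t, v => M.dist (s.eval M v) (t.eval M v)
  | .rel R t, v => M.rel R fun i => (t i).eval M v
  | .conn F φ, v => F fun i => (φ i).eval M v
  | .sup D k φ, v => ⨆ a : M.dom D, φ.eval M (Function.update v k a)
  | .inf D k φ, v => ⨅ a : M.dom D, φ.eval M (Function.update v k a)

/-- The variables occurring in a term. -/
def Term.vars : L.Term → Set ℕ
  | .var k => {k}
  | .func _ t => ⋃ i, (t i).vars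

/-- The free variables of a formula. -/
def Formula.freeVars : L.Formula → Set ℕ
  | .dist s t => s.vars ∪ t.vars
  | .rel _ t => ⋃ i, (t i).vars
  | .conn _ φ => ⋃ i, (φ i).freeVars
  | .sup _ k φ => φ.freeVars \ {k}
  | .inf _ k φ => φ.freeVars \ {k}

/-- Quantifier-free formulas: those without suprema and infima. -/
def Formula.IsQF : L.Formula → Prop
  | .dist _ _ => True
  | .rel _ _ => True
  | .conn _ φ => ∀ i, (φ i).IsQF
  | .sup _ _ _ => False
  | .inf _ _ _ => False

/-- Sentences are formulas without free variables. -/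
def Sentence (L : MetricLanguage) : Type := {φ : L.Formula // φ.freeVars = ∅}

/-- `M` assigns the value `0` to the sentence `φ` (the value does not depend on the assignment
`v`). -/
def Interpretation.Satisfies (M : L.Interpretation) (φ : L.Sentence) : Prop :=
  ∀ v : ℕ → M.carrier, φ.1.eval M v = 0

/-- `M ⊨ T`: `M` is an `L`-structure and all sentences of `T` have value `0` in `M`. -/
def Interpretation.Models (M : L.Interpretation) (T : Set L.Sentence) : Prop :=
  M.IsStructure ∧ ∀ φ ∈ T, M.Satisfies φ

/-- The theory of a class of interpretations. -/
def theoryOf (C : Set L.Interpretation) : Set L.Sentence :=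
  {φ | ∀ M ∈ C, M.Satisfies φ}

/-! ### Types

All notions are given relative to a set `Φ` of formulas. The type of a tuple is the
case where `Φ` consists of all formulas; the quantifier-free type is the case where `Φ` consists of
the quantifier-free formulas. -/

/-- The `Φ`-type of the tuple `X` in `M`: the map `φ ↦ φ^M(X)` on `Φ`. -/
def tp (Φ : Set L.Formula) (M : L.Interpretation) (X : ℕ → M.carrier) : Φ → ℝ :=
  fun φ => φ.1.eval M X

/-- The space of `Φ`-types of `ℕ`-tuples in models of `T`. -/
def TypeSpace (Φ : Set L.Formula) (T : Set L.Sentence) : Type :=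
  {ν : Φ → ℝ // ∃ (M : L.Interpretation) (X : ℕ → M.carrier), M.Models T ∧ ν = tp Φ M X}

/-- The space of `Φ`-types of tuples `X` with `X j` in the domain `D j`, in models of `T`. Its
topology (as a subtype of `Φ → ℝ`) is that of pointwise convergence on `Φ`, i.e. weak-*. -/
abbrev TypeSpaceIn (Φ : Set L.Formula) (T : Set L.Sentence) (D : ℕ → L.Dom) : Type :=
  {ν : Φ → ℝ // ∃ (M : L.Interpretation) (X : ℕ → M.carrier), M.Models T ∧
    (∀ j, X j ∈ M.dom (D j)) ∧ ν = tp Φ M X}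

/-- The inclusion of the types in the domains `D` into the space of all types. -/
def TypeSpaceIn.incl (Φ : Set L.Formula) (T : Set L.Sentence) (D : ℕ → L.Dom) :
    TypeSpaceIn Φ T D → TypeSpace Φ T :=
  fun ν => ⟨ν.1, let ⟨M, X, h, _, e⟩ := ν.2; ⟨M, X, h, e⟩⟩

/-- The logic topology: a set is open iff its intersection with the space of types in the domains
`D` is open for every `D`. -/
instance (Φ : Set L.Formula) (T : Set L.Sentence) : TopologicalSpace (TypeSpace Φ T) :=
  ⨆ D : ℕ → L.Dom, TopologicalSpace.coinduced (TypeSpaceIn.incl Φ T D) inferInstance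

/-- The restriction of types along an inclusion of sets of formulas. -/
def TypeSpace.restrict {Φ Ψ : Set L.Formula} (h : Ψ ⊆ Φ) (T : Set L.Sentence) :
    TypeSpace Φ T → TypeSpace Ψ T :=
  fun ν => ⟨fun φ => ν.1 ⟨φ.1, h φ.2⟩, by
    obtain ⟨M, X, hM, e⟩ := ν.2
    exact ⟨M, X, hM, by rw [e]; rfl⟩⟩

end MetricLanguage

open MetricLanguage

/-! ### Tracial W*-algebras and their language -/

/-- The seminorm `‖x‖₂ = τ(x* x)^{1/2}`. -/
def twoNorm {A : Type} [CStarAlgebra A] (τ : A → ℂ) (x : A) : ℝ :=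
  √(τ (star x * x)).re

/-- A tracial W*-algebra: a C*-algebra which is isometric to the dual of a Banach space, together
with a faithful tracial state which is weak-* continuous. -/
structure TracialWStarAlgebra where
  carrier : Type
  [cstar : CStarAlgebra carrier]
  tr : carrier →ₗ[ℂ] ℂ
  tr_nonneg : ∀ x, 0 ≤ (tr (star x * x)).re ∧ (tr (star x * x)).im = 0
  tr_one : tr 1 = 1
  tr_comm : ∀ x y, tr (x * y) = tr (y * x)
  tr_faithful : ∀ x, tr (star x * x) = 0 → x = 0
  exists_predual : ∃ (E : Type) (_ : NormedAddCommGroup E) (_ : NormedSpace ℂ E)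
    (_ : CompleteSpace E) (e : StrongDual ℂ E ≃ₗᵢ⋆[ℂ] carrier),
    Continuous fun f : WeakDual ℂ E => tr (e (WeakDual.toStrongDual f))

attribute [instance] TracialWStarAlgebra.cstar

instance (M : TracialWStarAlgebra) : WStarAlgebra M.carrier where
  exists_predual :=
    let ⟨E, i₁, i₂, i₃, e, _⟩ := M.exists_predual
    ⟨E, i₁, i₂, i₃, ⟨e⟩⟩

/-- Non-commutative *-polynomials in `d` variables: the free algebra on the symbols `x_i`
(left summand) and `x_i*` (right summand). -/
abbrev StarPoly (d : ℕ) : Type := FreeAlgebra ℂ (Fin d ⊕ Fin d)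

/-- Evaluation of a *-polynomial. -/
def StarPoly.eval {A : Type} [CStarAlgebra A] {d : ℕ} (p : StarPoly d) (X : Fin d → A) : A :=
  FreeAlgebra.lift ℂ (Sum.elim X fun i => star (X i)) p

/-- The supremum of `‖p(X)‖` over all tuples with `‖X i‖ ≤ r i` in tracial W*-algebras. -/
def StarPoly.normBound {d : ℕ} (p : StarPoly d) (r : Fin d → ℝ) : ℝ :=
  sSup {c | ∃ (M : TracialWStarAlgebra) (X : Fin d → M.carrier),
    (∀ i, ‖X i‖ ≤ r i) ∧ c = ‖p.eval X‖}

/-- The best Lipschitz constant of `p` in its `i`th variable with respect to `‖·‖₂`, over all tuples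
with `‖X j‖ ≤ r j` in tracial W*-algebras. -/
def StarPoly.lipschitzBound {d : ℕ} (p : StarPoly d) (r : Fin d → ℝ) (i : Fin d) : NNReal :=
  sInf {C | ∀ (M : TracialWStarAlgebra) (X : Fin d → M.carrier) (y : M.carrier),
    (∀ j, ‖X j‖ ≤ r j) → ‖y‖ ≤ r i →
    twoNorm M.tr (p.eval X - p.eval (Function.update X i y)) ≤ C * twoNorm M.tr (X i - y)}

/-- The function symbols: addition, multiplication, adjoint, scalar multiplications, `0`, `1`, and
a symbol for every *-polynomial. -/
inductive TrFunc : ℕ → Type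
  | plus : TrFunc 2
  | times : TrFunc 2
  | adj : TrFunc 1
  | scal (c : ℂ) : TrFunc 1
  | zero : TrFunc 0
  | one : TrFunc 0
  | poly {d : ℕ} (p : StarPoly d) : TrFunc d

/-- The relation symbols: real and imaginary part of the trace. -/
inductive TrRel : ℕ → Type
  | reTr : TrRel 1
  | imTr : TrRel 1

/-- Positive radii. -/
abbrev Radius : Type := {r : ℝ // 0 < r}

/-- The radius `c`, or `1` if `c` is not positive. -/
def Radius.ofReal (c : ℝ) : Radius := if h : 0 < c then ⟨c, h⟩ else ⟨1, one_pos⟩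

/-- Range bounds of the function symbols. -/
def TrFunc.range : ∀ {n : ℕ}, TrFunc n → (Fin n → Radius) → Radius
  | _, .plus, r => ⟨r 0 + r 1, add_pos (r 0).2 (r 1).2⟩
  | _, .times, r => ⟨r 0 * r 1, mul_pos (r 0).2 (r 1).2⟩
  | _, .adj, r => r 0
  | _, .scal c, r => Radius.ofReal (‖c‖ * r 0)
  | _, .zero, _ => ⟨1, one_pos⟩
  | _, .one, _ => ⟨1, one_pos⟩
  | _, .poly p, r => Radius.ofReal (p.normBound fun i => r i)

/-- Lipschitz constants of the function symbols. -/
def TrFunc.lipschitz : ∀ {n : ℕ}, TrFunc n → (Fin n → Radius) → Fin n → NNReal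
  | _, .plus, _, _ => 1
  | _, .times, r, i => ⟨r (1 - i), (r (1 - i)).2.le⟩
  | _, .adj, _, _ => 1
  | _, .scal c, _, _ => ‖c‖₊
  | _, .zero, _, _ => 0
  | _, .one, _, _ => 0
  | _, .poly p, r, i => p.lipschitzBound (fun j => r j) i

/-- The language of tracial W*-algebras. The domains of quantification are the balls `D_r`. -/
def Ltr : MetricLanguage where
  Dom := Radius
  diam r s := r + s
  Func := TrFunc
  funcRange f r := f.range r
  funcModulus f r i := .linear (f.lipschitz r i)
  Rel := TrRel
  relBound := fun {n} _ r => ∑ i : Fin n, (r i : ℝ)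
  relModulus _ _ _ := .linear 1

/-- The interpretation of the function symbols in a C*-algebra. -/
def TrFunc.interp {A : Type} [CStarAlgebra A] : ∀ {n : ℕ}, TrFunc n → (Fin n → A) → A
  | _, .plus, X => X 0 + X 1
  | _, .times, X => X 0 * X 1
  | _, .adj, X => star (X 0)
  | _, .scal c, X => c • X 0
  | _, .zero, _ => 0
  | _, .one, _ => 1
  | _, .poly p, X => p.eval X

/-- The interpretation of the relation symbols. -/
def TrRel.interp {A : Type} (τ : A → ℂ) : ∀ {n : ℕ}, TrRel n → (Fin n → A) → ℝ
  | _, .reTr, X => (τ (X 0)).re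
  | _, .imTr, X => (τ (X 0)).im

/-- The interpretation of `Ltr` in a C*-algebra `A` with a trace `τ`: the metric is that of `‖·‖₂`,
and `D_r` is the ball of radius `r` of the operator norm. -/
def trInterpretation (A : Type) [CStarAlgebra A] (τ : A → ℂ) : Ltr.Interpretation where
  carrier := A
  dist x y := twoNorm τ (x - y)
  dom r := {x | ‖x‖ ≤ r.1}
  func f X := TrFunc.interp f X
  rel R X := TrRel.interp τ R X

/-- The theory of tracial W*-algebras. -/
def Ttr : Set Ltr.Sentence :=
  theoryOf (Set.range fun M : TracialWStarAlgebra => trInterpretation M.carrier M.tr)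

/-- The set of all formulas. -/
def allFormulas : Set Ltr.Formula := Set.univ

/-- The set of quantifier-free formulas. -/
def qfFormulas : Set Ltr.Formula := {φ | φ.IsQF}

/-- The space of types of `ℕ`-tuples in models of `Ttr`. -/
abbrev FullType : Type := TypeSpace allFormulas Ttr

/-- The space of quantifier-free types (non-commutative laws). -/
abbrev QFType : Type := TypeSpace qfFormulas Ttr

/-- The restriction map from types to quantifier-free types. -/
def piQF : FullType → QFType :=
  TypeSpace.restrict (Set.subset_univ qfFormulas) Ttr

/-! ### Covering entropy -/

/-- `M_n(ℂ)`, with the operator norm on the Hilbert space `ℂⁿ`. -/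
abbrev Mat (n : ℕ) : Type := Matrix (Fin n) (Fin n) ℂ

/-- The normalized trace `tr_n` on `M_n(ℂ)`. -/
def trn (n : ℕ) : Mat n → ℂ := fun A => (n : ℂ)⁻¹ * A.trace

/-- `M_n(ℂ)` as an interpretation of `Ltr`. -/
def matInterpretation (n : ℕ) : Ltr.Interpretation := trInterpretation (Mat n) (trn n)

/-- The microstate space `Γ_r^{(n)}(K)` of matrix tuples `X` in `∏ D_{r_j}` whose type belongs to
`K`. -/
def microstates {Φ : Set Ltr.Formula} (r : ℕ → Radius) (n : ℕ) (K : Set (TypeSpace Φ Ttr)) :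
    Set (ℕ → Mat n) :=
  {X | (∀ j, ‖X j‖ ≤ r j) ∧ ∃ ν ∈ K, ν.1 = tp Φ (matInterpretation n) X}

/-- The orbital `(F, ε)`-neighbourhood of a set of matrix tuples. -/
def orbNhd {n : ℕ} (F : Finset ℕ) (ε : ℝ) (Ω : Set (ℕ → Mat n)) : Set (ℕ → Mat n) :=
  {Y | ∃ U ∈ unitary (Mat n), ∃ X ∈ Ω, ∀ i ∈ F, twoNorm (trn n) (Y i - U * X i * star U) < ε}

/-- The orbital covering number: the minimal cardinality of a set that orbitally `(F, ε)`-covers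
`Ω`. -/
def orbCovering {n : ℕ} (F : Finset ℕ) (ε : ℝ) (Ω : Set (ℕ → Mat n)) : ℕ∞ :=
  ⨅ (Ω' : Set (ℕ → Mat n)) (_ : Ω ⊆ orbNhd F ε Ω'), Ω'.encard

/-- `lim_{n → 𝒰} (1/n²) log K_{F,ε}^{orb}(Γ_r^{(n)}(O))`, with `log 0 = -∞`. The limit exists because
`[-∞, ∞]` is compact. -/
def growthRate {Φ : Set Ltr.Formula} (𝒰 : Ultrafilter ℕ) (r : ℕ → Radius) (F : Finset ℕ) (ε : ℝ)
    (O : Set (TypeSpace Φ Ttr)) : EReal :=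
  limUnder (𝒰 : Filter ℕ) fun n =>
    ((1 / (n : ℝ) ^ 2 : ℝ) : EReal) * ENNReal.log (orbCovering F ε (microstates r n O) : ENNReal)

/-- `Ent_{r,F,ε}(K)`: the infimum of the growth rates of the open sets containing `K`. -/
def entAt {Φ : Set Ltr.Formula} (𝒰 : Ultrafilter ℕ) (r : ℕ → Radius) (F : Finset ℕ) (ε : ℝ)
    (K : Set (TypeSpace Φ Ttr)) : EReal :=
  ⨅ (O : Set (TypeSpace Φ Ttr)) (_ : IsOpen O) (_ : K ⊆ O), growthRate 𝒰 r F ε O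

/-- The covering entropy of a set of `Φ`-types. -/
def entropyOf {Φ : Set Ltr.Formula} (𝒰 : Ultrafilter ℕ) (K : Set (TypeSpace Φ Ttr)) : EReal :=
  ⨆ (r : ℕ → Radius) (F : Finset ℕ) (ε : ℝ) (_ : 0 < ε), entAt 𝒰 r F ε K

/-- The covering entropy of a set of types. -/
def Ent (𝒰 : Ultrafilter ℕ) (K : Set FullType) : EReal := entropyOf 𝒰 K

/-- The quantifier-free covering entropy of a set of quantifier-free types. -/
def EntQF (𝒰 : Ultrafilter ℕ) (K : Set QFType) : EReal := entropyOf 𝒰 K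

end

namespace MetricLanguage

variable {L : MetricLanguage}

/-! ### Bounds for terms and formulas -/

/-! Only matrix tuples enter the entropy, so for fixed radii `r` everything happens on `matLimits
r`, the types that are pointwise limits of types of matrix tuples in the balls `D_{r_j}`. This set
is compact. Indeed formulas are bounded on products of domains, uniformly over all structures, so
the matrix types have compact closure in `allFormulas → ℝ`; and by Łoś's theorem (`los`) every point
of that closure is the type of a tuple in an ultraproduct of matrix algebras. A model is by
definition an `L`-structure satisfying `Ttr`, so the ultraproduct need not be recognized as a
W*-algebra.

An open set of types can be changed outside `matLimits r` without affecting its microstates. Two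
facts follow.

Variational principle (`Ent_eq_iSup`): if `K` is closed and every type in `K` has entropy below `c`,
uniformly in the sense that the supremum is below `c`, then the compact set `matLimits r ∩ K` is
covered by finitely many open sets of growth rate below `c`. Covering numbers are subadditive, and
the bounded factor lost in a finite union disappears under `(1/n²) log`, so the union still has
growth rate below `c`.

Preimages (`EntQF_eq_Ent_preimage`): if `O` is an open neighbourhood of the preimage of `K` under
`piQF`, then `piQF '' (matLimits r \ O)` is compact, hence closed, and misses `K`. Its complement is
an open neighbourhood of `K` all of whose microstates are microstates of `O`. The other inequality
is continuity of `piQF`.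

Part (2) is the second fact; part (1) combines it, for a single law, with the variational principle
on the closed fibre. -/

theorem Term.exists_dom (t : L.Term) (D : ℕ → L.Dom) :
    ∃ E : L.Dom, ∀ (M : L.Interpretation), M.IsStructure → ∀ w : ℕ → M.carrier,
      (∀ k, w k ∈ M.dom (D k)) → t.eval M w ∈ M.dom E := by
  induction t with
  | var k => exact ⟨D k, fun M _ w hw => hw k⟩
  | func f t ih =>
    choose E hE using ih
    exact ⟨L.funcRange f E, fun M hM w hw => hM.func_mem f E _ fun i => hE i M hM w hw⟩

/-- The condition `0 ≤ B` accounts for the empty supremum, whose value is `0`: a structure may have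
empty domains. -/
theorem abs_iSup_le_of_nonneg {ι : Type*} {f : ι → ℝ} {B : ℝ} (hB : 0 ≤ B)
    (h : ∀ i, |f i| ≤ B) : |⨆ i, f i| ≤ B := by
  rcases isEmpty_or_nonempty ι with hι | ⟨⟨i⟩⟩
  · simpa using hB
  · have hb : BddAbove (Set.range f) := ⟨B, by rintro _ ⟨i, rfl⟩; exact (abs_le.1 (h i)).2⟩
    exact abs_le.2 ⟨(abs_le.1 (h i)).1.trans (le_ciSup hb i),
      Real.iSup_le (fun i => (abs_le.1 (h i)).2) hB⟩

/-- No boundedness is needed, because the real infimum is defined as the negative of the supremum of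
the negated set, default values included. Infima thus reduce to suprema throughout. -/
theorem iInf_eq_neg_iSup_neg {ι : Type*} (f : ι → ℝ) : ⨅ i, f i = -⨆ i, -f i := by
  rw [iInf, Real.sInf_def, iSup]
  congr 2
  ext x
  simp [neg_eq_iff_eq_neg]

theorem abs_iInf_le_of_nonneg {ι : Type*} {f : ι → ℝ} {B : ℝ} (hB : 0 ≤ B)
    (h : ∀ i, |f i| ≤ B) : |⨅ i, f i| ≤ B := by
  rw [iInf_eq_neg_iSup_neg, abs_neg]
  exact abs_iSup_le_of_nonneg hB fun i => by rw [abs_neg]; exact h i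

theorem update_mem_dom {M : L.Interpretation} {D : ℕ → L.Dom} {w : ℕ → M.carrier}
    (hw : ∀ k, w k ∈ M.dom (D k)) {k : ℕ} {E : L.Dom} {a : M.carrier} (ha : a ∈ M.dom E) (j : ℕ) :
    Function.update w k a j ∈ M.dom (Function.update D k E j) := by
  by_cases h : j = k
  · subst h; simpa using ha
  · simpa [h] using hw j

/-- The values of a formula are bounded on each product of domains, uniformly over all
structures. -/
theorem Formula.exists_bound (φ : L.Formula) : ∀ D : ℕ → L.Dom,
    ∃ B : ℝ, 0 ≤ B ∧ ∀ (M : L.Interpretation), M.IsStructure → ∀ w : ℕ → M.carrier,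
      (∀ k, w k ∈ M.dom (D k)) → |φ.eval M w| ≤ B := by
  induction φ with
  | dist s t =>
    intro D
    obtain ⟨E, hE⟩ := s.exists_dom D
    obtain ⟨E', hE'⟩ := t.exists_dom D
    refine ⟨|L.diam E E'|, abs_nonneg _, fun M hM w hw => ?_⟩
    have h0 : 0 ≤ M.dist (s.eval M w) (t.eval M w) := by
      have := hM.dist_triangle (s.eval M w) (t.eval M w) (s.eval M w)
      rw [(hM.dist_eq_zero _ _).2 rfl, hM.dist_comm (t.eval M w)] at this
      linarith
    exact abs_le_abs_of_nonneg h0 (hM.dist_le E E' _ (hE M hM w hw) _ (hE' M hM w hw))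
  | rel R t =>
    intro D
    choose E hE using fun i => (t i).exists_dom D
    exact ⟨|L.relBound R E|, abs_nonneg _, fun M hM w hw =>
      (hM.rel_le R E _ fun i => hE i M hM w hw).trans (le_abs_self _)⟩
  | conn F φ ih =>
    intro D
    choose B hB0 hB using fun i => ih i D
    -- The connective is continuous, hence bounded on the compact box that contains the values of
    -- its arguments.
    obtain ⟨C, hC⟩ := (isCompact_Icc (a := -B) (b := B)).exists_bound_of_continuousOn
      F.continuous.continuousOn
    refine ⟨|C|, abs_nonneg _, fun M hM w hw => (hC _ ?_).trans (le_abs_self _)⟩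
    exact ⟨fun i => (abs_le.1 (hB i M hM w hw)).1, fun i => (abs_le.1 (hB i M hM w hw)).2⟩
  | sup E k φ ih =>
    intro D
    obtain ⟨B, hB0, hB⟩ := ih (Function.update D k E)
    exact ⟨B, hB0, fun M hM w hw => abs_iSup_le_of_nonneg hB0 fun a =>
      hB M hM _ (update_mem_dom hw a.2)⟩
  | inf E k φ ih =>
    intro D
    obtain ⟨B, hB0, hB⟩ := ih (Function.update D k E)
    exact ⟨B, hB0, fun M hM w hw => abs_iInf_le_of_nonneg hB0 fun a =>
      hB M hM _ (update_mem_dom hw a.2)⟩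

theorem Interpretation.IsStructure.dist_nonneg {M : L.Interpretation} (hM : M.IsStructure)
    (a b : M.carrier) : 0 ≤ M.dist a b := by
  have := hM.dist_triangle a b a
  rw [(hM.dist_eq_zero _ _).2 rfl, hM.dist_comm b] at this
  linarith

theorem Interpretation.IsStructure.abs_dist_sub_le {M : L.Interpretation} (hM : M.IsStructure)
    (a b a' b' : M.carrier) : |M.dist a b - M.dist a' b'| ≤ M.dist a a' + M.dist b b' := by
  have h1 := hM.dist_triangle a a' b
  have h2 := hM.dist_triangle a' b' b
  have h3 := hM.dist_triangle a' a b'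
  have h4 := hM.dist_triangle a b b'
  rw [hM.dist_comm b' b] at h2
  rw [hM.dist_comm a' a] at h3
  exact abs_le.2 ⟨by linarith, by linarith⟩

end MetricLanguage

/-- A bounded real function converges along an ultrafilter. -/
theorem Ultrafilter.tendsto_limUnder_of_bounded {I : Type*} (V : Ultrafilter I) {f : I → ℝ} {B : ℝ}
    (hf : ∀ i, |f i| ≤ B) : Tendsto f V (𝓝 (limUnder (V : Filter I) f)) := by
  obtain ⟨x, -, hx⟩ := (isCompact_Icc (a := -B) (b := B)).ultrafilter_le_nhds (V.map f)
    (tendsto_principal.2 (Eventually.of_forall fun i => abs_le.1 (hf i)) :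
      Tendsto f V (𝓟 (Set.Icc (-B) B)))
  exact tendsto_nhds_limUnder ⟨x, hx⟩

namespace MetricLanguage

variable {L : MetricLanguage} {I : Type}

/-! ### Ultraproducts -/

/-- The elements of the product of the `M i` that lie in a common domain. -/
def BddSeq (M : I → L.Interpretation) : Type :=
  {a : ∀ i, (M i).carrier // ∃ D, ∀ i, a i ∈ (M i).dom D}

/-- The hypotheses for the construction of ultraproducts: structures with nonempty
domains, which are uniformly directed. -/
structure IsGoodFamily (M : I → L.Interpretation) : Prop where
  isStructure : ∀ i, (M i).IsStructure
  nonempty : ∀ D i, ((M i).dom D).Nonempty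
  directed : ∀ D E, ∃ G, ∀ i, (M i).dom D ⊆ (M i).dom G ∧ (M i).dom E ⊆ (M i).dom G

variable {M : I → L.Interpretation}

theorem IsGoodFamily.tendsto_dist (hM : IsGoodFamily M) (V : Ultrafilter I) (a b : BddSeq M) :
    Tendsto (fun i => (M i).dist (a.1 i) (b.1 i)) V
      (𝓝 (limUnder (V : Filter I) fun i => (M i).dist (a.1 i) (b.1 i))) := by
  obtain ⟨D, hD⟩ := a.2
  obtain ⟨E, hE⟩ := b.2
  refine V.tendsto_limUnder_of_bounded (B := L.diam D E) fun i => ?_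
  rw [abs_of_nonneg ((hM.isStructure i).dist_nonneg _ _)]
  exact (hM.isStructure i).dist_le _ _ _ (hD i) _ (hE i)

/-- Two sequences are identified in the ultraproduct if their distance tends to zero. -/
def ultraSetoid (hM : IsGoodFamily M) (V : Ultrafilter I) : Setoid (BddSeq M) where
  r a b := Tendsto (fun i => (M i).dist (a.1 i) (b.1 i)) V (𝓝 0)
  iseqv :=
    { refl := fun a => by
        simp only [fun i => ((hM.isStructure i).dist_eq_zero (a.1 i) (a.1 i)).2 rfl]
        exact tendsto_const_nhds
      symm := fun {a b} h => by
        simpa only [fun i => (hM.isStructure i).dist_comm (a.1 i) (b.1 i)] using h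
      trans := fun {a b c} h h' => by
        refine squeeze_zero (fun i => (hM.isStructure i).dist_nonneg _ _)
          (fun i => (hM.isStructure i).dist_triangle _ (b.1 i) _) ?_
        simpa using h.add h' }

/-- The coordinatewise action of a function symbol on bounded sequences. -/
def BddSeq.func (hM : IsGoodFamily M) {n : ℕ} (f : L.Func n) (a : Fin n → BddSeq M) : BddSeq M :=
  ⟨fun i => (M i).func f fun j => (a j).1 i, by
    choose D hD using fun j => (a j).2
    exact ⟨_, fun i => (hM.isStructure i).func_mem f D _ fun j => hD j i⟩⟩

/-- The ultraproduct of a family of structures. -/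
noncomputable def ultraproduct (hM : IsGoodFamily M) (V : Ultrafilter I) : L.Interpretation where
  carrier := Quotient (ultraSetoid hM V)
  dist x y := limUnder (V : Filter I) fun i => (M i).dist (x.out.1 i) (y.out.1 i)
  dom D := {x | ∃ a : BddSeq M, (∀ i, a.1 i ∈ (M i).dom D) ∧ Quotient.mk _ a = x}
  func f x := Quotient.mk _ (BddSeq.func hM f fun j => (x j).out)
  rel R x := limUnder (V : Filter I) fun i => (M i).rel R fun j => (x j).out.1 i

section

variable (hM : IsGoodFamily M) (V : Ultrafilter I)

/-- The class of a bounded sequence in the ultraproduct. -/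
def ultraMk (a : BddSeq M) : (ultraproduct hM V).carrier :=
  Quotient.mk (ultraSetoid hM V) a

variable {hM V}

theorem exists_ultraMk_eq (x : (ultraproduct hM V).carrier) : ∃ a, ultraMk hM V a = x :=
  ⟨Quotient.out x, Quotient.out_eq x⟩

theorem ultraMk_eq_iff {a b : BddSeq M} : ultraMk hM V a = ultraMk hM V b ↔
    Tendsto (fun i => (M i).dist (a.1 i) (b.1 i)) V (𝓝 0) :=
  Quotient.eq (r := ultraSetoid hM V)

theorem ultraMk_out_equiv (a : BddSeq M) :
    Tendsto (fun i => (M i).dist ((Quotient.out (ultraMk hM V a) : BddSeq M).1 i) (a.1 i)) V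
      (𝓝 0) :=
  Quotient.mk_out (s := ultraSetoid hM V) a

/-- The distance is defined through chosen representatives. Exchanging them for `a` and `b` changes
the coordinate distances by an error that tends to zero along `V`, so any representatives compute
it. -/
theorem tendsto_ultra_dist (a b : BddSeq M) :
    Tendsto (fun i => (M i).dist (a.1 i) (b.1 i)) V
      (𝓝 ((ultraproduct hM V).dist (ultraMk hM V a) (ultraMk hM V b))) := by
  have h := hM.tendsto_dist V (Quotient.out (ultraMk hM V a)) (Quotient.out (ultraMk hM V b))
  have h0 : Tendsto (fun i => (M i).dist (a.1 i) (b.1 i) -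
      (M i).dist ((Quotient.out (ultraMk hM V a) : BddSeq M).1 i)
        ((Quotient.out (ultraMk hM V b) : BddSeq M).1 i)) V (𝓝 0) := by
    refine squeeze_zero_norm (a := fun i =>
      (M i).dist ((Quotient.out (ultraMk hM V a) : BddSeq M).1 i) (a.1 i) +
      (M i).dist ((Quotient.out (ultraMk hM V b) : BddSeq M).1 i) (b.1 i)) (fun i => ?_) ?_
    · rw [Real.norm_eq_abs, abs_sub_comm]
      exact (hM.isStructure i).abs_dist_sub_le _ _ _ _
    · simpa using (ultraMk_out_equiv (hM := hM) (V := V) a).add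
        (ultraMk_out_equiv (hM := hM) (V := V) b)
  have h1 := h0.add h
  simp only [sub_add_cancel, zero_add] at h1
  exact h1

/-- If a function of `n` arguments is continuous in each argument, it respects the identification
of bounded sequences. The function is only assumed to be continuous on products of domains, and
its continuity is measured by a pseudometric `e`. -/
theorem tendsto_of_coordinatewise {n : ℕ} {β : I → Type*} (g : ∀ i, (Fin n → (M i).carrier) → β i)
    (e : ∀ i, β i → β i → ℝ) (he0 : ∀ i x, e i x x = 0) (he : ∀ i x y, 0 ≤ e i x y)
    (het : ∀ i x y z, e i x z ≤ e i x y + e i y z)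
    (c : (Fin n → L.Dom) → Fin n → ContinuityModulus)
    (hg : ∀ i (D : Fin n → L.Dom) (a : Fin n → (M i).carrier) (j : Fin n) (b : (M i).carrier),
      (∀ j, a j ∈ (M i).dom (D j)) → b ∈ (M i).dom (D j) →
      e i (g i a) (g i (Function.update a j b)) ≤ (c D j).toFun ((M i).dist (a j) b).toNNReal)
    (hM : IsGoodFamily M) {a b : Fin n → BddSeq M}
    (hab : ∀ j, Tendsto (fun i => (M i).dist ((a j).1 i) ((b j).1 i)) V (𝓝 0)) :
    Tendsto (fun i => e i (g i fun j => (a j).1 i) (g i fun j => (b j).1 i)) V (𝓝 0) := by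
  classical
  choose D hD using fun j => (a j).2
  choose E hE using fun j => (b j).2
  -- A modulus is attached to a product of domains, so `a j` and `b j` must lie in one common
  -- domain, the same for all `i`.
  choose G hG using fun j => hM.directed (D j) (E j)
  -- The coordinates of `a` are exchanged for those of `b` one at a time, and the triangle
  -- inequality for `e` adds up the errors.
  have key : ∀ s : Finset (Fin n), Tendsto (fun i => e i (g i fun j => (a j).1 i)
      (g i (s.piecewise (fun j => (b j).1 i) (fun j => (a j).1 i)))) V (𝓝 0) := by
    intro s
    induction s using Finset.induction_on with
    | empty => simp [he0]
    | insert j s hj ih =>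
      simp only [Finset.piecewise_insert]
      refine squeeze_zero (fun i => he _ _ _) (fun i => het _ _ (g i (s.piecewise
        (fun j => (b j).1 i) (fun j => (a j).1 i))) _) ?_
      rw [← add_zero (0 : ℝ)]
      refine ih.add ?_
      have hc : Tendsto (fun i => (((c G j).toFun
          ((M i).dist ((a j).1 i) ((b j).1 i)).toNNReal : NNReal) : ℝ)) V (𝓝 0) := by
        have h1 := (((c G j).continuous'.tendsto _).comp
          ((continuous_real_toNNReal.tendsto 0).comp (hab j)))
        rw [Real.toNNReal_zero, (c G j).map_zero'] at h1
        exact NNReal.tendsto_coe.2 h1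
      refine squeeze_zero (fun i => he _ _ _) (fun i => ?_) hc
      have h2 := hg i G (s.piecewise (fun j => (b j).1 i) (fun j => (a j).1 i)) j ((b j).1 i)
        (fun k => ?_) ((hG j i).2 (hE j i))
      · rwa [Finset.piecewise_eq_of_notMem _ _ _ hj] at h2
      · by_cases hk : k ∈ s
        · simpa [hk] using (hG k i).2 (hE k i)
        · simpa [hk] using (hG k i).1 (hD k i)
  simpa using key Finset.univ

theorem ultra_func_mk {n : ℕ} (f : L.Func n) (a : Fin n → BddSeq M) :
    (ultraproduct hM V).func f (fun j => ultraMk hM V (a j)) =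
      ultraMk hM V (BddSeq.func hM f a) := by
  refine ultraMk_eq_iff.2 ?_
  exact tendsto_of_coordinatewise (fun i => (M i).func f) (fun i => (M i).dist)
    (fun i x => ((hM.isStructure i).dist_eq_zero x x).2 rfl)
    (fun i => (hM.isStructure i).dist_nonneg) (fun i => (hM.isStructure i).dist_triangle)
    (L.funcModulus f) (fun i => (hM.isStructure i).func_modulus f) hM
    fun j => ultraMk_out_equiv (a j)

theorem tendsto_ultra_rel {n : ℕ} (R : L.Rel n) (a : Fin n → BddSeq M) :
    Tendsto (fun i => (M i).rel R fun j => (a j).1 i) V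
      (𝓝 ((ultraproduct hM V).rel R fun j => ultraMk hM V (a j))) := by
  have h : Tendsto (fun i => (M i).rel R fun j =>
      (Quotient.out (ultraMk hM V (a j)) : BddSeq M).1 i) V
      (𝓝 ((ultraproduct hM V).rel R fun j => ultraMk hM V (a j))) := by
    choose D hD using fun j => (Quotient.out (ultraMk hM V (a j)) : BddSeq M).2
    exact V.tendsto_limUnder_of_bounded (B := L.relBound R D) fun i =>
      (hM.isStructure i).rel_le R D _ fun j => hD j i
  have h0 := tendsto_of_coordinatewise (V := V) (fun i => (M i).rel R) (fun i x y => |x - y|)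
    (fun i x => by simp) (fun i x y => abs_nonneg _) (fun i => abs_sub_le)
    (L.relModulus R) (fun i => (hM.isStructure i).rel_modulus R) hM
    fun j => ultraMk_out_equiv (hM := hM) (a j)
  have h1 := h.sub ((tendsto_zero_iff_abs_tendsto_zero _).2 h0)
  simpa using h1

theorem exists_rep_of_mem_dom {D : L.Dom} {x : (ultraproduct hM V).carrier}
    (hx : x ∈ (ultraproduct hM V).dom D) :
    ∃ a : BddSeq M, (∀ i, a.1 i ∈ (M i).dom D) ∧ ultraMk hM V a = x := hx

theorem ultraMk_mem_dom {D : L.Dom} {a : BddSeq M} (ha : ∀ i, a.1 i ∈ (M i).dom D) :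
    ultraMk hM V a ∈ (ultraproduct hM V).dom D := ⟨a, ha, rfl⟩

theorem ultraMk_update {n : ℕ} (a : Fin n → BddSeq M) (j : Fin n) (b : BddSeq M) :
    Function.update (fun j => ultraMk hM V (a j)) j (ultraMk hM V b) =
      fun k => ultraMk hM V (Function.update a j b k) := by
  ext k
  by_cases h : k = j
  · subst h; simp
  · simp [h]

theorem val_update {J : Type*} [DecidableEq J] (a : J → BddSeq M) (j : J) (b : BddSeq M) (i : I) :
    (fun k => (Function.update a j b k).1 i) = Function.update (fun k => (a k).1 i) j (b.1 i) := by
  ext k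
  by_cases h : k = j
  · subst h; simp
  · simp [h]

theorem tendsto_modulus (c : ContinuityModulus) (a b : BddSeq M) :
    Tendsto (fun i => ((c.toFun ((M i).dist (a.1 i) (b.1 i)).toNNReal : NNReal) : ℝ)) V
      (𝓝 (c.toFun ((ultraproduct hM V).dist (ultraMk hM V a) (ultraMk hM V b)).toNNReal)) :=
  NNReal.tendsto_coe.2 ((c.continuous'.tendsto _).comp
    ((continuous_real_toNNReal.tendsto _).comp (tendsto_ultra_dist a b)))

/-- Domains of an ultraproduct by a countably incomplete ultrafilter are complete. -/
theorem ultraproduct_dom_complete {h : I → ℕ} (hh : Tendsto h V atTop) (D : L.Dom)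
    (u : ℕ → (ultraproduct hM V).carrier) (hu : ∀ k, u k ∈ (ultraproduct hM V).dom D)
    (hc : ∀ ε > 0, ∃ N, ∀ k ≥ N, ∀ l ≥ N, (ultraproduct hM V).dist (u k) (u l) < ε) :
    ∃ a ∈ (ultraproduct hM V).dom D, ∀ ε > 0, ∃ N, ∀ k ≥ N,
      (ultraproduct hM V).dist (u k) a < ε := by
  classical
  choose a ha hau using fun k => exists_rep_of_mem_dom (hu k)
  obtain rfl : (fun k => ultraMk hM V (a k)) = u := funext hau
  choose N hN using fun m : ℕ => hc (1 / ((m : ℝ) + 1)) Nat.one_div_pos_of_nat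
  -- `P i m` collects the finitely many Cauchy estimates at the index `i` that involve only numbers
  -- up to `m`; each is strict in the limit, so `P i m` holds for `V`-almost all `i`.
  let P : I → ℕ → Prop := fun i m => ∀ p ∈ Finset.range (m + 1), ∀ k ∈ Finset.range (m + 1),
    ∀ l ∈ Finset.range (m + 1), N p ≤ k → N p ≤ l →
      (M i).dist ((a k).1 i) ((a l).1 i) < 1 / ((p : ℝ) + 1)
  have hP : ∀ m, ∀ᶠ i in (V : Filter I), P i m := by
    intro m
    simp only [P]
    refine (Finset.eventually_all _).2 fun p _ => (Finset.eventually_all _).2 fun k _ =>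
      (Finset.eventually_all _).2 fun l _ => ?_
    by_cases hk : N p ≤ k ∧ N p ≤ l
    · filter_upwards [(tendsto_ultra_dist (a k) (a l)).eventually_lt_const (hN p k hk.1 l hk.2)]
        with i hi _ _ using hi
    · exact Eventually.of_forall fun i h1 h2 => absurd ⟨h1, h2⟩ hk
  have hP0 : ∀ i, P i 0 := by
    intro i p hp k hk l hl _ _
    simp only [zero_add, Finset.range_one, Finset.mem_singleton] at hp hk hl
    subst hp hk hl
    rw [((hM.isStructure i).dist_eq_zero _ _).2 rfl]
    exact Nat.one_div_pos_of_nat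
  -- A diagonal choice: the cap `h i` keeps `m i` finite, and `h → ∞` makes `m` tend to infinity
  -- along `V`. Since `P i 0` always holds, `P i (m i)` does too.
  let m : I → ℕ := fun i => Nat.findGreatest (P i) (h i)
  have hm : ∀ k, ∀ᶠ i in (V : Filter I), k ≤ m i := fun k => by
    filter_upwards [hP k, hh.eventually_ge_atTop k] with i h1 h2
    exact Nat.le_findGreatest h2 h1
  have hPm : ∀ i, P i (m i) := fun i => Nat.findGreatest_spec (Nat.zero_le _) (hP0 i)
  let b : BddSeq M := ⟨fun i => (a (m i)).1 i, D, fun i => ha (m i) i⟩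
  refine ⟨ultraMk hM V b, ultraMk_mem_dom fun i => ha (m i) i, fun ε hε => ?_⟩
  obtain ⟨p, hp⟩ := exists_nat_one_div_lt hε
  refine ⟨N p, fun k hk => lt_of_le_of_lt ?_ hp⟩
  refine le_of_tendsto (tendsto_ultra_dist (a k) b) ?_
  filter_upwards [hm p, hm k] with i h1 h2
  exact (hPm i p (by simpa using Nat.lt_succ_of_le h1) k (by simpa using Nat.lt_succ_of_le h2)
    (m i) (by simp) hk (hk.trans h2)).le

theorem ultraproduct_isStructure {h : I → ℕ} (hh : Tendsto h V atTop) :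
    (ultraproduct hM V).IsStructure where
  dist_eq_zero x y := by
    obtain ⟨a, rfl⟩ := exists_ultraMk_eq x
    obtain ⟨b, rfl⟩ := exists_ultraMk_eq y
    rw [ultraMk_eq_iff]
    have := tendsto_ultra_dist (hM := hM) (V := V) a b
    exact ⟨fun h => by rwa [h] at this, fun h => tendsto_nhds_unique this h⟩
  dist_comm x y := by
    obtain ⟨a, rfl⟩ := exists_ultraMk_eq x
    obtain ⟨b, rfl⟩ := exists_ultraMk_eq y
    refine tendsto_nhds_unique (tendsto_ultra_dist (hM := hM) (V := V) a b) ?_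
    simpa only [fun i => (hM.isStructure i).dist_comm (a.1 i) (b.1 i)] using
      tendsto_ultra_dist (hM := hM) (V := V) b a
  dist_triangle x y z := by
    obtain ⟨a, rfl⟩ := exists_ultraMk_eq x
    obtain ⟨b, rfl⟩ := exists_ultraMk_eq y
    obtain ⟨c, rfl⟩ := exists_ultraMk_eq z
    exact le_of_tendsto_of_tendsto' (tendsto_ultra_dist a c)
      ((tendsto_ultra_dist a b).add (tendsto_ultra_dist b c))
      fun i => (hM.isStructure i).dist_triangle _ _ _
  dom_complete := ultraproduct_dom_complete hh
  dom_cover x := by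
    obtain ⟨a, rfl⟩ := exists_ultraMk_eq x
    obtain ⟨D, hD⟩ := a.2
    exact ⟨D, ultraMk_mem_dom hD⟩
  dist_le D E x hx y hy := by
    obtain ⟨a, ha, rfl⟩ := exists_rep_of_mem_dom hx
    obtain ⟨b, hb, rfl⟩ := exists_rep_of_mem_dom hy
    exact le_of_tendsto' (tendsto_ultra_dist a b) fun i =>
      (hM.isStructure i).dist_le D E _ (ha i) _ (hb i)
  func_mem f D x hx := by
    choose a ha hax using fun j => exists_rep_of_mem_dom (hx j)
    obtain rfl : (fun j => ultraMk hM V (a j)) = x := funext hax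
    rw [ultra_func_mk]
    exact ultraMk_mem_dom fun i => (hM.isStructure i).func_mem f D _ fun j => ha j i
  func_modulus f D x j y hx hy := by
    choose a ha hax using fun j => exists_rep_of_mem_dom (hx j)
    obtain rfl : (fun j => ultraMk hM V (a j)) = x := funext hax
    obtain ⟨b, hb, rfl⟩ := exists_rep_of_mem_dom hy
    rw [ultraMk_update, ultra_func_mk, ultra_func_mk]
    refine le_of_tendsto_of_tendsto' (tendsto_ultra_dist _ _) (tendsto_modulus _ (a j) b)
      fun i => ?_
    have := (hM.isStructure i).func_modulus f D (fun k => (a k).1 i) j (b.1 i)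
      (fun k => ha k i) (hb i)
    rwa [← val_update] at this
  rel_le R D x hx := by
    choose a ha hax using fun j => exists_rep_of_mem_dom (hx j)
    obtain rfl : (fun j => ultraMk hM V (a j)) = x := funext hax
    exact le_of_tendsto' (tendsto_ultra_rel R a).abs fun i =>
      (hM.isStructure i).rel_le R D _ fun j => ha j i
  rel_modulus R D x j y hx hy := by
    choose a ha hax using fun j => exists_rep_of_mem_dom (hx j)
    obtain rfl : (fun j => ultraMk hM V (a j)) = x := funext hax
    obtain ⟨b, hb, rfl⟩ := exists_rep_of_mem_dom hy
    rw [ultraMk_update]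
    refine le_of_tendsto_of_tendsto' ((tendsto_ultra_rel R a).sub (tendsto_ultra_rel R _)).abs
      (tendsto_modulus _ (a j) b) fun i => ?_
    have := (hM.isStructure i).rel_modulus R D (fun k => (a k).1 i) j (b.1 i)
      (fun k => ha k i) (hb i)
    rwa [← val_update] at this

/-! ### Łoś's theorem -/

theorem BddSeq.exists_doms (v : ℕ → BddSeq M) :
    ∃ D : ℕ → L.Dom, ∀ k i, (v k).1 i ∈ (M i).dom (D k) := by
  choose D hD using fun k => (v k).2
  exact ⟨D, hD⟩

theorem exists_bddSeq_term_eval (hM : IsGoodFamily M) (t : L.Term) (v : ℕ → BddSeq M) :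
    ∃ a : BddSeq M, (∀ i, a.1 i = t.eval (M i) fun k => (v k).1 i) ∧
      ∀ V : Ultrafilter I, t.eval (ultraproduct hM V) (fun k => ultraMk hM V (v k)) =
        ultraMk hM V a := by
  induction t with
  | var k => exact ⟨v k, fun i => rfl, fun V => rfl⟩
  | func f t ih =>
    choose a ha hau using ih
    refine ⟨BddSeq.func hM f a, fun i => ?_, fun V => ?_⟩
    · simp only [BddSeq.func, Term.eval, ha]
    · rw [← ultra_func_mk, Term.eval]
      simp only [hau]

/-- This is the quantifier step of Łoś's theorem. An element of the ultraproduct's domain has a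
representative inside the domains of the factors, which gives one inequality; a sequence of
near-maximizers in the factors gives the other. Nonempty domains exclude the default value of the
supremum. -/
theorem tendsto_iSup_dom {E : L.Dom} {B : ℝ}
    {f : ∀ i, (M i).carrier → ℝ} {g : (ultraproduct hM V).carrier → ℝ}
    (hf : ∀ i, ∀ a ∈ (M i).dom E, |f i a| ≤ B)
    (hg : ∀ a : BddSeq M, (∀ i, a.1 i ∈ (M i).dom E) →
      Tendsto (fun i => f i (a.1 i)) V (𝓝 (g (ultraMk hM V a)))) :
    Tendsto (fun i => ⨆ a : (M i).dom E, f i a) V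
      (𝓝 (⨆ a : (ultraproduct hM V).dom E, g a)) := by
  have hne : ∀ i, Nonempty ((M i).dom E) := fun i => (hM.nonempty E i).to_subtype
  have hbf : ∀ i, BddAbove (Set.range fun a : (M i).dom E => f i a) := fun i =>
    ⟨B, by rintro _ ⟨a, rfl⟩; exact (abs_le.1 (hf i a a.2)).2⟩
  have hbg : BddAbove (Set.range fun a : (ultraproduct hM V).dom E => g a) := by
    refine ⟨B, ?_⟩
    rintro _ ⟨⟨x, hx⟩, rfl⟩
    obtain ⟨a, ha, rfl⟩ := exists_rep_of_mem_dom hx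
    exact le_of_tendsto' (hg a ha) fun i => (abs_le.1 (hf i _ (ha i))).2
  have hB : 0 ≤ |B| := abs_nonneg B
  have hlim := V.tendsto_limUnder_of_bounded (f := fun i => ⨆ a : (M i).dom E, f i a) (B := |B|)
    fun i => abs_iSup_le_of_nonneg hB fun a => (hf i a a.2).trans (le_abs_self B)
  convert hlim using 2
  refine le_antisymm ?_ (le_of_forall_pos_le_add fun ε hε => ?_)
  · choose a ha using fun i => hM.nonempty E i
    have : Nonempty ((ultraproduct hM V).dom E) :=
      ⟨⟨_, ultraMk_mem_dom (a := ⟨a, E, ha⟩) ha⟩⟩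
    refine ciSup_le ?_
    rintro ⟨x, hx⟩
    obtain ⟨a, ha, rfl⟩ := exists_rep_of_mem_dom hx
    exact le_of_tendsto_of_tendsto' (hg a ha) hlim fun i => le_ciSup (hbf i) ⟨a.1 i, ha i⟩
  -- Points within `ε` of the supremum, one in each factor, form a single bounded sequence.
  · choose a ha using fun i => exists_lt_of_lt_ciSup
      (sub_lt_self (⨆ a : (M i).dom E, f i a) hε)
    have h1 := hg ⟨fun i => a i, E, fun i => (a i).2⟩ fun i => (a i).2
    have h2 : limUnder (V : Filter I) (fun i => ⨆ a : (M i).dom E, f i a) ≤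
        g (ultraMk hM V ⟨fun i => a i, E, fun i => (a i).2⟩) + ε :=
      le_of_tendsto_of_tendsto' hlim (h1.add_const ε) fun i => by
        have := ha i
        simp only at this ⊢
        linarith
    exact h2.trans (by
      gcongr
      exact le_ciSup hbg ⟨_, ultraMk_mem_dom (a := ⟨fun i => a i, E, fun i => (a i).2⟩)
        fun i => (a i).2⟩)

theorem los (φ : L.Formula) : ∀ v : ℕ → BddSeq M,
    Tendsto (fun i => φ.eval (M i) fun k => (v k).1 i) V
      (𝓝 (φ.eval (ultraproduct hM V) fun k => ultraMk hM V (v k))) := by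
  have hupd : ∀ (v : ℕ → BddSeq M) (k : ℕ) (b : BddSeq M),
      Function.update (fun j => ultraMk hM V (v j)) k (ultraMk hM V b) =
        fun j => ultraMk hM V (Function.update v k b j) := by
    intro v k b
    ext j
    by_cases h : j = k
    · subst h; simp
    · simp [h]
  induction φ with
  | dist s t =>
    intro v
    obtain ⟨a, ha, hau⟩ := exists_bddSeq_term_eval hM s v
    obtain ⟨b, hb, hbu⟩ := exists_bddSeq_term_eval hM t v
    simp only [Formula.eval, hau, hbu, ← ha, ← hb]
    exact tendsto_ultra_dist a b
  | rel R t =>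
    intro v
    choose a ha hau using fun j => exists_bddSeq_term_eval hM (t j) v
    simp only [Formula.eval, hau, ← ha]
    exact tendsto_ultra_rel R a
  | conn F φ ih =>
    intro v
    exact (F.continuous.tendsto _).comp (tendsto_pi_nhds.2 fun j => ih j v)
  | sup E k φ ih =>
    intro v
    obtain ⟨D, hD⟩ := BddSeq.exists_doms v
    obtain ⟨B, -, hB⟩ := φ.exists_bound (Function.update D k E)
    refine tendsto_iSup_dom (B := B)
      (f := fun i a => φ.eval (M i) (Function.update (fun j => (v j).1 i) k a))
      (g := fun x => φ.eval (ultraproduct hM V)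
        (Function.update (fun j => ultraMk hM V (v j)) k x))
      (fun i a ha => hB _ (hM.isStructure i) _ (update_mem_dom (fun j => hD j i) ha))
      fun a ha => ?_
    have := ih (Function.update v k a)
    simp only [val_update] at this
    rwa [hupd]
  | inf E k φ ih =>
    intro v
    obtain ⟨D, hD⟩ := BddSeq.exists_doms v
    obtain ⟨B, -, hB⟩ := φ.exists_bound (Function.update D k E)
    simp only [Formula.eval, iInf_eq_neg_iSup_neg]
    refine (tendsto_iSup_dom (B := B)
      (f := fun i a => -φ.eval (M i) (Function.update (fun j => (v j).1 i) k a))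
      (g := fun x => -φ.eval (ultraproduct hM V)
        (Function.update (fun j => ultraMk hM V (v j)) k x))
      (fun i a ha => ?_) fun a ha => ?_).neg
    · rw [abs_neg]
      exact hB _ (hM.isStructure i) _ (update_mem_dom (fun j => hD j i) ha)
    · have := ih (Function.update v k a)
      simp only [val_update] at this
      rw [hupd]
      exact this.neg

/-- By Łoś's theorem the value of a sentence is the limit of the constant `0`; the map `h` serves
only the completeness of the domains. -/
theorem ultraproduct_models {h : I → ℕ} (hh : Tendsto h V atTop) {T : Set L.Sentence}
    (hT : ∀ i, (M i).Models T) : (ultraproduct hM V).Models T := by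
  refine ⟨ultraproduct_isStructure hh, fun φ hφ v => ?_⟩
  choose a ha using fun k => exists_ultraMk_eq (v k)
  obtain rfl : (fun k => ultraMk hM V (a k)) = v := funext ha
  refine tendsto_nhds_unique (los φ.1 a) ?_
  simp only [fun i => (hT i).2 φ hφ fun k => (a k).1 i]
  exact tendsto_const_nhds

end

end MetricLanguage

namespace TracialWStarAlgebra

variable (M : TracialWStarAlgebra)

/-! ### The 2-norm of a tracial W*-algebra -/

/-- Both `a* a` and `(a + 1)* (a + 1)` have real trace, and they differ by `2a + 1`. -/
theorem im_tr_of_isSelfAdjoint {a : M.carrier} (ha : star a = a) : (M.tr a).im = 0 := by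
  have h1 := (M.tr_nonneg (a + 1)).2
  have h2 := (M.tr_nonneg a).2
  have e : star (a + 1) * (a + 1) = star a * a + (a + a) + 1 := by
    rw [star_add, star_one, ha]; noncomm_ring
  rw [e, map_add, map_add, map_add, M.tr_one] at h1
  simp only [Complex.add_im, Complex.one_im, h2] at h1
  linarith

theorem tr_star (x : M.carrier) : M.tr (star x) = star (M.tr x) := by
  have h1 := M.im_tr_of_isSelfAdjoint (a := x + star x) (by simp [add_comm])
  have h2 := M.im_tr_of_isSelfAdjoint (a := Complex.I • (x - star x)) (by
    rw [star_smul, star_sub, star_star, Complex.star_def, Complex.conj_I, neg_smul, ← smul_neg,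
      neg_sub])
  rw [map_add] at h1
  rw [map_smul, map_sub] at h2
  simp at h1 h2
  refine Complex.ext ?_ ?_
  · simp; linarith
  · simp; linarith

/-- The inner product `⟨x, y⟩ = τ(x* y)`. -/
noncomputable abbrev core : InnerProductSpace.Core ℂ M.carrier where
  inner x y := M.tr (star x * y)
  conj_inner_symm x y := by
    rw [← Complex.star_def, ← M.tr_star]; simp
  re_inner_nonneg x := (M.tr_nonneg x).1
  add_left x y z := by simp [add_mul]
  smul_left x y r := by simp
  definite x := M.tr_faithful x

theorem twoNorm_add_le (x y : M.carrier) :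
    twoNorm M.tr (x + y) ≤ twoNorm M.tr x + twoNorm M.tr y :=
  @norm_add_le M.carrier (@SeminormedAddCommGroup.toSeminormedAddGroup _
    (@NormedAddCommGroup.toSeminormedAddCommGroup _
      (InnerProductSpace.Core.toNormedAddCommGroup (cd := M.core)))) x y

theorem norm_tr_star_mul_le (x y : M.carrier) :
    ‖M.tr (star x * y)‖ ≤ twoNorm M.tr x * twoNorm M.tr y :=
  InnerProductSpace.Core.norm_inner_le_norm (c := M.core.toCore) x y

theorem twoNorm_sq (x : M.carrier) : twoNorm M.tr x ^ 2 = (M.tr (star x * x)).re :=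
  Real.sq_sqrt (M.tr_nonneg x).1

theorem twoNorm_nonneg (x : M.carrier) : 0 ≤ twoNorm M.tr x := Real.sqrt_nonneg _

theorem twoNorm_eq_zero_iff {x : M.carrier} : twoNorm M.tr x = 0 ↔ x = 0 := by
  refine ⟨fun h => M.tr_faithful x (Complex.ext ?_ (M.tr_nonneg x).2), ?_⟩
  · rw [← M.twoNorm_sq, h]; simp
  · rintro rfl; simp [twoNorm]

theorem twoNorm_zero : twoNorm M.tr 0 = 0 := M.twoNorm_eq_zero_iff.2 rfl

theorem twoNorm_smul (c : ℂ) (x : M.carrier) : twoNorm M.tr (c • x) = ‖c‖ * twoNorm M.tr x := by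
  have h : M.tr (star (c • x) * (c • x)) = ((‖c‖ ^ 2 : ℝ) : ℂ) * M.tr (star x * x) := by
    rw [star_smul, smul_mul_smul_comm, map_smul, smul_eq_mul, Complex.star_def,
      Complex.conj_mul', Complex.ofReal_pow]
  rw [twoNorm, h, Complex.re_ofReal_mul, Real.sqrt_mul (sq_nonneg _), Real.sqrt_sq (norm_nonneg _)]
  rfl

theorem twoNorm_neg (x : M.carrier) : twoNorm M.tr (-x) = twoNorm M.tr x := by
  simp [twoNorm]

theorem twoNorm_star (x : M.carrier) : twoNorm M.tr (star x) = twoNorm M.tr x := by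
  rw [twoNorm, twoNorm, star_star, M.tr_comm]

/-- The element `‖x‖² - x* x` is positive, say equal to `c* c`, and the trace of `(c y)* (c y)` is
nonnegative. -/
theorem twoNorm_mul_le (x y : M.carrier) : twoNorm M.tr (x * y) ≤ ‖x‖ * twoNorm M.tr y := by
  let _ := CStarAlgebra.spectralOrder M.carrier
  have := CStarAlgebra.spectralOrderedRing M.carrier
  obtain ⟨c, hc⟩ := CStarAlgebra.nonneg_iff_eq_star_mul_self.1
    (sub_nonneg.2 (CStarAlgebra.star_mul_le_algebraMap_norm_sq (a := x)))
  have e : star (c * y) * (c * y) = ((‖x‖ ^ 2 : ℝ) : ℂ) • (star y * y) - star (x * y) * (x * y) := by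
    calc star (c * y) * (c * y) = star y * (star c * c) * y := by simp [mul_assoc]
      _ = _ := by
        rw [← hc, mul_sub, sub_mul, IsScalarTower.algebraMap_apply ℝ ℂ M.carrier,
          ← Algebra.commutes, ← Algebra.smul_def, smul_mul_assoc, star_mul]
        simp [mul_assoc]
  have h1 := (M.tr_nonneg (c * y)).1
  rw [e, map_sub, map_smul, Complex.sub_re, smul_eq_mul, Complex.re_ofReal_mul, ← M.twoNorm_sq,
    ← M.twoNorm_sq, ← mul_pow, sub_nonneg] at h1
  exact le_of_sq_le_sq h1 (mul_nonneg (norm_nonneg _) (M.twoNorm_nonneg _))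

theorem twoNorm_mul_le' (x y : M.carrier) : twoNorm M.tr (x * y) ≤ twoNorm M.tr x * ‖y‖ := by
  rw [← M.twoNorm_star, star_mul, mul_comm, ← norm_star y, ← M.twoNorm_star x]
  exact M.twoNorm_mul_le _ _

theorem twoNorm_one : twoNorm M.tr 1 = 1 := by simp [twoNorm, M.tr_one]

theorem twoNorm_le_norm (x : M.carrier) : twoNorm M.tr x ≤ ‖x‖ := by
  simpa [M.twoNorm_one] using M.twoNorm_mul_le x 1

theorem norm_tr_le_twoNorm (x : M.carrier) : ‖M.tr x‖ ≤ twoNorm M.tr x := by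
  simpa [M.twoNorm_one] using M.norm_tr_star_mul_le 1 x

theorem nontrivial : Nontrivial M.carrier :=
  ⟨⟨1, 0, fun h => one_ne_zero (by rw [← M.tr_one, h, map_zero] : (1 : ℂ) = 0)⟩⟩

theorem norm_one : ‖(1 : M.carrier)‖ = 1 :=
  have := M.nontrivial
  CStarRing.norm_one

end TracialWStarAlgebra

/-! ### Uniform bounds for *-polynomials -/

namespace StarPoly

theorem eval_ι {A : Type} [CStarAlgebra A] {d : ℕ} (X : Fin d → A) (s : Fin d ⊕ Fin d) :
    StarPoly.eval (FreeAlgebra.ι ℂ s) X = Sum.elim X (fun i => star (X i)) s := by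
  simp [StarPoly.eval]

theorem exists_norm_le {d : ℕ} (p : StarPoly d) (r : Fin d → ℝ) :
    ∃ B : ℝ, 0 ≤ B ∧ ∀ (M : TracialWStarAlgebra) (X : Fin d → M.carrier),
      (∀ i, ‖X i‖ ≤ r i) → ‖p.eval X‖ ≤ B := by
  induction p using FreeAlgebra.induction with
  | grade0 c =>
    refine ⟨‖c‖, norm_nonneg _, fun M X _ => ?_⟩
    rw [StarPoly.eval, AlgHom.commutes, norm_algebraMap, M.norm_one, mul_one]
  | grade1 s =>
    refine ⟨|Sum.elim r r s|, abs_nonneg _, fun M X hX => le_trans ?_ (le_abs_self _)⟩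
    rw [eval_ι]
    cases s with
    | inl i => exact hX i
    | inr i => simpa using hX i
  | mul p q hp hq =>
    obtain ⟨B, hB0, hB⟩ := hp
    obtain ⟨C, hC0, hC⟩ := hq
    refine ⟨B * C, mul_nonneg hB0 hC0, fun M X hX => ?_⟩
    rw [StarPoly.eval, map_mul]
    exact (norm_mul_le _ _).trans (mul_le_mul (hB M X hX) (hC M X hX) (norm_nonneg _) hB0)
  | add p q hp hq =>
    obtain ⟨B, hB0, hB⟩ := hp
    obtain ⟨C, hC0, hC⟩ := hq
    refine ⟨B + C, add_nonneg hB0 hC0, fun M X hX => ?_⟩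
    rw [StarPoly.eval, map_add]
    exact (norm_add_le _ _).trans (add_le_add (hB M X hX) (hC M X hX))

theorem norm_eval_le_normBound {d : ℕ} (p : StarPoly d) (r : Fin d → ℝ) (M : TracialWStarAlgebra)
    (X : Fin d → M.carrier) (hX : ∀ i, ‖X i‖ ≤ r i) : ‖p.eval X‖ ≤ p.normBound r := by
  obtain ⟨B, -, hB⟩ := p.exists_norm_le r
  refine le_csSup ⟨B, ?_⟩ ⟨M, X, hX, rfl⟩
  rintro _ ⟨M, X, hX, rfl⟩
  exact hB M X hX

/-- By induction on `p`. Products use the Leibniz rule together with the uniform operator-norm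
bounds, since `‖·‖₂` of a product is controlled by the operator norm of one factor. -/
theorem exists_lipschitz {d : ℕ} (p : StarPoly d) (r : Fin d → ℝ) (i : Fin d) :
    ∃ C : NNReal, ∀ (M : TracialWStarAlgebra) (X : Fin d → M.carrier) (y : M.carrier),
      (∀ j, ‖X j‖ ≤ r j) → ‖y‖ ≤ r i →
      twoNorm M.tr (p.eval X - p.eval (Function.update X i y)) ≤ C * twoNorm M.tr (X i - y) := by
  induction p using FreeAlgebra.induction with
  | grade0 c =>
    refine ⟨0, fun M X y _ _ => ?_⟩
    rw [StarPoly.eval, StarPoly.eval, AlgHom.commutes, AlgHom.commutes, sub_self, M.twoNorm_zero,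
      NNReal.coe_zero, zero_mul]
  | grade1 s =>
    refine ⟨1, fun M X y _ _ => ?_⟩
    rw [eval_ι, eval_ι, NNReal.coe_one, one_mul]
    cases s with
    | inl j =>
      by_cases h : j = i
      · subst h; simp
      · simpa [h, M.twoNorm_zero] using M.twoNorm_nonneg _
    | inr j =>
      by_cases h : j = i
      · subst h
        simp only [Sum.elim_inr, Function.update_self]
        rw [← star_sub, M.twoNorm_star]
      · simpa [h, M.twoNorm_zero] using M.twoNorm_nonneg _
  | mul p q hp hq =>
    obtain ⟨B, hB0, hB⟩ := exists_norm_le p r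
    obtain ⟨B', hB0', hB'⟩ := exists_norm_le q r
    obtain ⟨C, hC⟩ := hp
    obtain ⟨C', hC'⟩ := hq
    lift B to NNReal using hB0
    lift B' to NNReal using hB0'
    refine ⟨C * B' + B * C', fun M X y hX hy => ?_⟩
    have hX' : ∀ j, ‖Function.update X i y j‖ ≤ r j := fun j => by
      by_cases h : j = i
      · subst h; simpa using hy
      · simpa [h] using hX j
    have e : StarPoly.eval (p * q) X - StarPoly.eval (p * q) (Function.update X i y) =
        (StarPoly.eval p X - StarPoly.eval p (Function.update X i y)) * StarPoly.eval q X +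
        StarPoly.eval p (Function.update X i y) *
          (StarPoly.eval q X - StarPoly.eval q (Function.update X i y)) := by
      simp only [StarPoly.eval, map_mul]
      noncomm_ring
    rw [e]
    refine (M.twoNorm_add_le _ _).trans ?_
    push_cast
    rw [add_mul, mul_right_comm (C : ℝ), mul_assoc (B : ℝ)]
    refine add_le_add ((M.twoNorm_mul_le' _ _).trans ?_) ((M.twoNorm_mul_le _ _).trans ?_)
    · exact mul_le_mul (hC M X y hX hy) (hB' M X hX) (norm_nonneg _)
        (mul_nonneg C.2 (M.twoNorm_nonneg _))
    · exact mul_le_mul (hB M _ hX') (hC' M X y hX hy) (M.twoNorm_nonneg _) B.2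
  | add p q hp hq =>
    obtain ⟨C, hC⟩ := hp
    obtain ⟨C', hC'⟩ := hq
    refine ⟨C + C', fun M X y hX hy => ?_⟩
    have e : StarPoly.eval (p + q) X - StarPoly.eval (p + q) (Function.update X i y) =
        (StarPoly.eval p X - StarPoly.eval p (Function.update X i y)) +
          (StarPoly.eval q X - StarPoly.eval q (Function.update X i y)) := by
      simp only [StarPoly.eval, map_add]
      abel
    rw [e, NNReal.coe_add, add_mul]
    exact (M.twoNorm_add_le _ _).trans (add_le_add (hC M X y hX hy) (hC' M X y hX hy))

/-- The infimum of the Lipschitz constants is again one: dividing by a positive distance exhibits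
the quotient as a lower bound of all of them. At distance zero any constant suffices. -/
theorem twoNorm_eval_sub_le_lipschitzBound {d : ℕ} (p : StarPoly d) (r : Fin d → ℝ) (i : Fin d)
    (M : TracialWStarAlgebra) (X : Fin d → M.carrier) (y : M.carrier) (hX : ∀ j, ‖X j‖ ≤ r j)
    (hy : ‖y‖ ≤ r i) : twoNorm M.tr (p.eval X - p.eval (Function.update X i y)) ≤
      p.lipschitzBound r i * twoNorm M.tr (X i - y) := by
  rcases (M.twoNorm_nonneg (X i - y)).eq_or_lt with h | h
  · obtain ⟨C, hC⟩ := p.exists_lipschitz r i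
    simpa [← h] using hC M X y hX hy
  · rw [← div_le_iff₀ h]
    have h0 : 0 ≤ twoNorm M.tr (p.eval X - p.eval (Function.update X i y)) /
      twoNorm M.tr (X i - y) := div_nonneg (M.twoNorm_nonneg _) h.le
    lift twoNorm M.tr (p.eval X - p.eval (Function.update X i y)) /
      twoNorm M.tr (X i - y) to NNReal using h0 with q hq
    rw [NNReal.coe_le_coe]
    refine le_csInf (p.exists_lipschitz r i) fun C hC => ?_
    rw [← NNReal.coe_le_coe, hq, div_le_iff₀ h]
    exact hC M X y hX hy

end StarPoly

/-! ### Tracial W*-algebras as structures -/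

/-- In the default case `c ≤ 0`, so the radius `1` is a weaker bound. -/
theorem le_radius_ofReal {c x : ℝ} (h : x ≤ c) : x ≤ (Radius.ofReal c).1 := by
  unfold Radius.ofReal
  split_ifs with h0
  · exact h
  · exact h.trans ((not_lt.1 h0).trans zero_le_one)

namespace TracialWStarAlgebra

variable (M : TracialWStarAlgebra)

theorem norm_interp_le_range {n : ℕ} (f : TrFunc n) (r : Fin n → Radius) (X : Fin n → M.carrier)
    (hX : ∀ i, ‖X i‖ ≤ r i) : ‖f.interp X‖ ≤ f.range r := by
  cases f with
  | plus => exact (norm_add_le (X 0) (X 1)).trans (add_le_add (hX 0) (hX 1))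
  | times =>
    exact (norm_mul_le (X 0) (X 1)).trans
      (mul_le_mul (hX 0) (hX 1) (norm_nonneg _) (r 0).2.le)
  | adj => exact (norm_star _).trans_le (hX 0)
  | scal c =>
    refine le_radius_ofReal ((norm_smul_le c (X 0)).trans ?_)
    exact mul_le_mul_of_nonneg_left (hX 0) (norm_nonneg c)
  | zero => simp [TrFunc.interp, TrFunc.range]
  | one => exact M.norm_one.le
  | poly p => exact le_radius_ofReal (p.norm_eval_le_normBound _ M X hX)

theorem twoNorm_interp_sub_le {n : ℕ} (f : TrFunc n) (r : Fin n → Radius) (X : Fin n → M.carrier)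
    (i : Fin n) (y : M.carrier) (hX : ∀ i, ‖X i‖ ≤ r i) (hy : ‖y‖ ≤ r i) :
    twoNorm M.tr (f.interp X - f.interp (Function.update X i y)) ≤
      f.lipschitz r i * twoNorm M.tr (X i - y) := by
  cases f with
  | plus => fin_cases i <;> simp [TrFunc.interp, TrFunc.lipschitz]
  | times =>
    fin_cases i
    · simp only [TrFunc.interp, TrFunc.lipschitz, Fin.zero_eta, Function.update_self, ne_eq,
        one_ne_zero, not_false_eq_true, Function.update_of_ne, sub_zero]
      rw [← sub_mul, mul_comm]
      exact (M.twoNorm_mul_le' _ _).trans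
        (mul_le_mul_of_nonneg_left (hX 1) (M.twoNorm_nonneg _))
    · simp only [TrFunc.interp, TrFunc.lipschitz, Fin.mk_one, Function.update_self, ne_eq,
        zero_ne_one, not_false_eq_true, Function.update_of_ne, sub_self]
      rw [← mul_sub]
      exact (M.twoNorm_mul_le _ _).trans
        (mul_le_mul_of_nonneg_right (hX 0) (M.twoNorm_nonneg _))
  | adj =>
    fin_cases i
    simp only [TrFunc.interp, TrFunc.lipschitz, Fin.zero_eta, Function.update_self,
      NNReal.coe_one, one_mul]
    rw [← star_sub, M.twoNorm_star]
  | scal c =>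
    fin_cases i
    simp only [TrFunc.interp, TrFunc.lipschitz, Fin.zero_eta, Function.update_self, coe_nnnorm]
    rw [← smul_sub, M.twoNorm_smul]
  | zero => exact i.elim0
  | one => exact i.elim0
  | poly p => exact p.twoNorm_eval_sub_le_lipschitzBound _ i M X y hX hy

theorem twoNorm_sub_comm (x y : M.carrier) : twoNorm M.tr (x - y) = twoNorm M.tr (y - x) := by
  rw [← M.twoNorm_neg, neg_sub]

theorem abs_interp_rel_le {n : ℕ} (R : TrRel n) (r : Fin n → Radius) (X : Fin n → M.carrier)
    (hX : ∀ i, ‖X i‖ ≤ r i) : |R.interp M.tr X| ≤ ∑ i, (r i : ℝ) := by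
  cases R with
  | reTr =>
    simpa [TrRel.interp] using (Complex.abs_re_le_norm _).trans
      (((M.norm_tr_le_twoNorm _).trans (M.twoNorm_le_norm _)).trans (hX 0))
  | imTr =>
    simpa [TrRel.interp] using (Complex.abs_im_le_norm _).trans
      (((M.norm_tr_le_twoNorm _).trans (M.twoNorm_le_norm _)).trans (hX 0))

theorem abs_interp_rel_sub_le {n : ℕ} (R : TrRel n) (X : Fin n → M.carrier) (i : Fin n)
    (y : M.carrier) : |R.interp M.tr X - R.interp M.tr (Function.update X i y)| ≤
      twoNorm M.tr (X i - y) := by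
  refine le_trans ?_ (M.norm_tr_le_twoNorm _)
  cases R with
  | reTr =>
    fin_cases i
    simpa [TrRel.interp] using Complex.abs_re_le_norm (M.tr (X 0 - y))
  | imTr =>
    fin_cases i
    simpa [TrRel.interp] using Complex.abs_im_le_norm (M.tr (X 0 - y))

/-- In finite dimension the operator-norm ball is compact, so a subsequence converges in operator
norm and a fortiori in `‖·‖₂`; a Cauchy sequence with a convergent subsequence converges. -/
theorem exists_limit_of_twoNorm_cauchy [FiniteDimensional ℂ M.carrier] {r : ℝ}
    (u : ℕ → M.carrier) (hu : ∀ k, ‖u k‖ ≤ r)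
    (hc : ∀ ε > 0, ∃ N, ∀ k ≥ N, ∀ l ≥ N, twoNorm M.tr (u k - u l) < ε) :
    ∃ a, ‖a‖ ≤ r ∧ ∀ ε > 0, ∃ N, ∀ k ≥ N, twoNorm M.tr (u k - a) < ε := by
  have := FiniteDimensional.proper ℂ M.carrier
  obtain ⟨a, ha, φ, hφ, hlim⟩ := (isCompact_closedBall (0 : M.carrier) r).tendsto_subseq
    (x := u) (fun k => by simpa using hu k)
  refine ⟨a, by simpa using ha, fun ε hε => ?_⟩
  obtain ⟨N, hN⟩ := hc (ε / 2) (half_pos hε)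
  obtain ⟨K, hK⟩ := Metric.tendsto_atTop.1 hlim (ε / 2) (half_pos hε)
  refine ⟨N, fun k hk => ?_⟩
  have h1 := hN k hk (φ (max N K)) ((le_max_left _ _).trans (hφ.id_le _))
  have h2 := hK (max N K) (le_max_right _ _)
  rw [dist_eq_norm] at h2
  have h3 := M.twoNorm_add_le (u k - u (φ (max N K))) (u (φ (max N K)) - a)
  rw [sub_add_sub_cancel] at h3
  have h4 := M.twoNorm_le_norm (u (φ (max N K)) - a)
  simp only [Function.comp_apply] at h2
  linarith

theorem trInterpretation_isStructure [FiniteDimensional ℂ M.carrier] :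
    (trInterpretation M.carrier M.tr).IsStructure where
  dist_eq_zero a b := M.twoNorm_eq_zero_iff.trans sub_eq_zero
  dist_comm := M.twoNorm_sub_comm
  dist_triangle (a b c : M.carrier) := by
    simpa [trInterpretation] using M.twoNorm_add_le (a - b) (b - c)
  dom_complete r u hu hc := M.exists_limit_of_twoNorm_cauchy u hu hc
  dom_cover (a : M.carrier) := ⟨⟨‖a‖ + 1, by positivity⟩, (le_add_of_nonneg_right zero_le_one :
    ‖a‖ ≤ ‖a‖ + 1)⟩
  dist_le r s (a : M.carrier) ha (b : M.carrier) hb :=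
    (M.twoNorm_le_norm _).trans ((norm_sub_le a b).trans (add_le_add ha hb))
  func_mem f r X hX := M.norm_interp_le_range f r X hX
  func_modulus f r X i y hX hy := by
    refine (M.twoNorm_interp_sub_le f r X i y hX hy).trans (le_of_eq ?_)
    simp [Ltr, ContinuityModulus.linear, trInterpretation, Real.coe_toNNReal _
      (M.twoNorm_nonneg _)]
  rel_le R r X hX := M.abs_interp_rel_le R r X hX
  rel_modulus R r X i y hX hy := by
    refine (M.abs_interp_rel_sub_le R X i y).trans (le_of_eq ?_)
    simp [Ltr, ContinuityModulus.linear, trInterpretation, Real.coe_toNNReal _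
      (M.twoNorm_nonneg _)]

end TracialWStarAlgebra

/-! ### Matrix algebras -/

/-- A finite-dimensional space is reflexive, so the dual of `A` is a predual. The isometry must be
conjugate-linear, hence the identification with the bidual is followed by the adjoint. -/
theorem exists_predual_of_finiteDimensional {A : Type} [CStarAlgebra A] [FiniteDimensional ℂ A]
    (τ : A →ₗ[ℂ] ℂ) : ∃ (E : Type) (_ : NormedAddCommGroup E) (_ : NormedSpace ℂ E)
    (_ : CompleteSpace E) (e : StrongDual ℂ E ≃ₗᵢ⋆[ℂ] A),
    Continuous fun f : WeakDual ℂ E => τ (e (WeakDual.toStrongDual f)) := by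
  let j : A ≃ₗᵢ[ℂ] StrongDual ℂ (StrongDual ℂ A) :=
    (NormedSpace.inclusionInDoubleDualLi ℂ (E := A)).toLinearIsometryEquiv (by
      have h : ∀ (V : Type) [NormedAddCommGroup V] [NormedSpace ℂ V] [FiniteDimensional ℂ V],
          Module.finrank ℂ (StrongDual ℂ V) = Module.finrank ℂ V := fun V _ _ _ =>
        (LinearEquiv.finrank_eq (LinearMap.toContinuousLinearMap (𝕜 := ℂ) (E := V)
          (F' := ℂ))).symm.trans Subspace.dual_finrank_eq
      rw [h, h])
  -- The functional `a ↦ conj (τ (a*))`: under the isometry `τ` becomes evaluation at `τ'` followed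
  -- by conjugation, which is weak-* continuous.
  let τ' : StrongDual ℂ A := ⟨(starLinearEquiv ℂ (A := ℂ)).symm.toLinearMap.comp
    (τ.comp (starLinearEquiv ℂ (A := A)).toLinearMap), LinearMap.continuous_of_finiteDimensional _⟩
  refine ⟨StrongDual ℂ A, inferInstance, inferInstance, inferInstance,
    j.symm.trans (starₗᵢ ℂ), ?_⟩
  have h : ∀ f : WeakDual ℂ (StrongDual ℂ A),
      τ (j.symm.trans (starₗᵢ ℂ) (WeakDual.toStrongDual f)) = star (f τ') := by
    intro f
    obtain ⟨a, ha⟩ := j.surjective (WeakDual.toStrongDual f)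
    have h2 : f τ' = j a τ' := by rw [ha]; rfl
    rw [← ha, h2, LinearIsometryEquiv.trans_apply, j.symm_apply_apply]
    change τ (star a) = star (star (τ (star a)))
    rw [star_star]
  simp only [h]
  exact continuous_star.comp (WeakDual.eval_continuous τ')

open scoped ComplexOrder in
/-- `M_n(ℂ)` with its normalized trace, for `n ≠ 0`. -/
noncomputable def matTracial (n : ℕ) [NeZero n] : TracialWStarAlgebra where
  carrier := Mat n
  tr := (n : ℂ)⁻¹ • Matrix.traceLinearMap (Fin n) ℂ ℂ
  tr_nonneg x := by
    have h := (Matrix.posSemidef_conjTranspose_mul_self x).trace_nonneg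
    have h2 : (0 : ℂ) ≤ (n : ℂ)⁻¹ * (star x * x).trace := mul_nonneg (by simp) h
    exact ⟨(Complex.le_def.1 h2).1, (Complex.le_def.1 h2).2.symm⟩
  tr_one := by simp
  tr_comm x y := by simp [Matrix.trace_mul_comm x y]
  tr_faithful x h := by
    have h2 : (n : ℂ)⁻¹ * (star x * x).trace = 0 := h
    exact Matrix.trace_conjTranspose_mul_self_eq_zero_iff.1
      ((mul_eq_zero.1 h2).resolve_left (by simp [NeZero.ne n]))
  exists_predual := exists_predual_of_finiteDimensional _

theorem matInterpretation_isStructure (n : ℕ) [NeZero n] : (matInterpretation n).IsStructure :=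
  have : FiniteDimensional ℂ (matTracial n).carrier :=
    inferInstanceAs (FiniteDimensional ℂ (Mat n))
  (matTracial n).trInterpretation_isStructure

theorem matInterpretation_models (n : ℕ) [NeZero n] : (matInterpretation n).Models Ttr :=
  ⟨matInterpretation_isStructure n, fun _ hφ => hφ _ ⟨matTracial n, rfl⟩⟩

open MetricLanguage

/-! ### Topology of the type spaces -/

namespace MetricLanguage

variable {L : MetricLanguage}

theorem TypeSpace.continuous_val (Φ : Set L.Formula) (T : Set L.Sentence) :
    Continuous fun ν : TypeSpace Φ T => ν.1 :=
  continuous_iSup_dom.2 fun _ => continuous_coinduced_dom.2 continuous_subtype_val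

instance (Φ : Set L.Formula) (T : Set L.Sentence) : T2Space (TypeSpace Φ T) :=
  T2Space.of_injective_continuous Subtype.val_injective (TypeSpace.continuous_val Φ T)

theorem TypeSpaceIn.continuous_incl (Φ : Set L.Formula) (T : Set L.Sentence) (D : ℕ → L.Dom) :
    Continuous (TypeSpaceIn.incl Φ T D) :=
  continuous_iff_coinduced_le.2 (le_iSup (fun D : ℕ → L.Dom =>
    TopologicalSpace.coinduced (TypeSpaceIn.incl Φ T D) inferInstance) D)

theorem TypeSpace.continuous_restrict {Φ Ψ : Set L.Formula} (h : Ψ ⊆ Φ) (T : Set L.Sentence) :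
    Continuous (TypeSpace.restrict h T) := by
  refine continuous_iSup_dom.2 fun D => continuous_coinduced_dom.2 ?_
  let R : TypeSpaceIn Φ T D → TypeSpaceIn Ψ T D := fun ν => ⟨fun φ => ν.1 ⟨φ.1, h φ.2⟩, by
    obtain ⟨M, X, hM, hX, e⟩ := ν.2
    exact ⟨M, X, hM, hX, by rw [e]; rfl⟩⟩
  have hR : Continuous R := by
    refine Continuous.subtype_mk (continuous_pi fun φ => ?_) _
    exact (continuous_apply _).comp continuous_subtype_val
  exact (TypeSpaceIn.continuous_incl Ψ T D).comp hR

end MetricLanguage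

/-! ### Limits of types of matrix tuples -/

/-- The types of matrix tuples in the domains `D_{r_j}`. -/
def matTypes (r : ℕ → Radius) : Set (allFormulas → ℝ) :=
  {ν | ∃ (n : ℕ) (_ : NeZero n) (X : ℕ → Mat n), (∀ j, ‖X j‖ ≤ r j) ∧
    ν = tp allFormulas (matInterpretation n) X}

theorem isGoodFamily_matInterpretation {I : Type} (n : I → ℕ) (hn : ∀ i, NeZero (n i)) :
    IsGoodFamily fun i => matInterpretation (n i) where
  isStructure i := matInterpretation_isStructure (n i)
  nonempty r i := ⟨(0 : Mat (n i)), norm_zero.trans_le r.2.le⟩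
  directed (r s : Radius) := ⟨(max r s : Radius), fun _ =>
    ⟨fun _ hx => le_trans hx (Subtype.coe_le_coe.2 (le_max_left r s)),
      fun _ hx => le_trans hx (Subtype.coe_le_coe.2 (le_max_right r s))⟩⟩

/-- Limits of types of matrix tuples are realized in ultraproducts of matrix algebras. -/
theorem exists_model_of_mem_closure_matTypes {r : ℕ → Radius} {ν : allFormulas → ℝ}
    (hν : ν ∈ closure (matTypes r)) :
    ∃ (N : Ltr.Interpretation) (X : ℕ → N.carrier), N.Models Ttr ∧
      (∀ j, X j ∈ N.dom (r j)) ∧ ν = tp allFormulas N X := by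
  have hne := mem_closure_iff_comap_neBot.1 hν
  -- The first factor makes the types converge to `ν`; the factor `ℕ` supplies a function tending to
  -- infinity along `V`, as completeness of the ultraproduct requires.
  let V : Ultrafilter (matTypes r × ℕ) :=
    Ultrafilter.of (comap ((↑) : matTypes r → allFormulas → ℝ) (𝓝 ν) ×ˢ atTop)
  have hV : (V : Filter (matTypes r × ℕ)) ≤ comap (↑) (𝓝 ν) ×ˢ atTop := Ultrafilter.of_le _
  choose n hn X hX hXν using fun p : matTypes r => p.2
  have hM := isGoodFamily_matInterpretation (fun p : matTypes r × ℕ => n p.1) fun p => hn p.1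
  let x : ℕ → BddSeq fun p : matTypes r × ℕ => matInterpretation (n p.1) := fun j =>
    ⟨fun p => X p.1 j, r j, fun p => hX p.1 j⟩
  refine ⟨ultraproduct hM V, fun j => ultraMk hM V (x j),
    ultraproduct_models (tendsto_snd.mono_left hV) fun p => matInterpretation_models (n p.1),
    fun j => ultraMk_mem_dom fun p => hX p.1 j, ?_⟩
  ext φ
  have h1 : Tendsto (fun p : matTypes r × ℕ => p.1.1) V (𝓝 ν) :=
    (tendsto_comap.comp tendsto_fst).mono_left hV
  refine tendsto_nhds_unique ((continuous_apply φ).continuousAt.tendsto.comp h1) ?_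
  exact (los (hM := hM) (V := V) φ.1 x).congr fun p => (congrFun (hXν p.1) φ).symm

theorem isCompact_closure_matTypes (r : ℕ → Radius) : IsCompact (closure (matTypes r)) := by
  choose B hB0 hB using fun φ : allFormulas => φ.1.exists_bound (L := Ltr) r
  refine (isCompact_univ_pi fun φ => isCompact_Icc (a := -B φ) (b := B φ)).closure_of_subset ?_
  rintro _ ⟨n, hn, X, hX, rfl⟩ φ -
  exact abs_le.1 (hB φ _ (matInterpretation_isStructure n) X hX)

/-- The types that are limits of types of matrix tuples in the domains `D_{r_j}`. -/
def matLimits (r : ℕ → Radius) : Set FullType := {ν | ν.1 ∈ closure (matTypes r)}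

/-- The logic topology on all types is at least as fine as pointwise convergence. Compactness is
therefore established among the types in the domains `r`, where the topology is pointwise, and
pushed forward along the continuous inclusion. -/
theorem isCompact_matLimits (r : ℕ → Radius) : IsCompact (matLimits r) := by
  have h : matLimits r = TypeSpaceIn.incl allFormulas Ttr r ''
      (Subtype.val ⁻¹' closure (matTypes r)) := by
    ext ν
    constructor
    · intro hν
      exact ⟨⟨ν.1, exists_model_of_mem_closure_matTypes hν⟩, hν, rfl⟩
    · rintro ⟨ν, hν, rfl⟩
      exact hν
  rw [h]
  refine IsCompact.image (IsInducing.subtypeVal.isCompact_iff.2 ?_)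
    (TypeSpaceIn.continuous_incl _ _ _)
  convert isCompact_closure_matTypes r
  exact Set.image_preimage_eq_of_subset fun ν hν =>
    ⟨⟨ν, exists_model_of_mem_closure_matTypes hν⟩, rfl⟩

/-- The type of a matrix tuple. -/
noncomputable def matType {n : ℕ} [NeZero n] (X : ℕ → Mat n) : FullType :=
  ⟨tp allFormulas (matInterpretation n) X, matInterpretation n, X, matInterpretation_models n, rfl⟩

theorem matType_mem_matLimits {n : ℕ} [hn : NeZero n] {r : ℕ → Radius} {X : ℕ → Mat n}
    (hX : ∀ j, ‖X j‖ ≤ r j) : matType X ∈ matLimits r :=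
  subset_closure ⟨n, hn, X, hX, rfl⟩

theorem mem_microstates_iff {n : ℕ} [NeZero n] {r : ℕ → Radius} {X : ℕ → Mat n}
    {K : Set FullType} : X ∈ microstates r n K ↔ (∀ j, ‖X j‖ ≤ r j) ∧ matType X ∈ K := by
  refine and_congr_right fun _ => ⟨?_, fun h => ⟨_, h, rfl⟩⟩
  rintro ⟨ν, hν, e⟩
  rwa [show matType X = ν from Subtype.ext e.symm]

theorem mem_microstates_qf_iff {n : ℕ} [NeZero n] {r : ℕ → Radius} {X : ℕ → Mat n}
    {K : Set QFType} : X ∈ microstates r n K ↔ (∀ j, ‖X j‖ ≤ r j) ∧ piQF (matType X) ∈ K := by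
  refine and_congr_right fun _ => ⟨?_, fun h => ⟨_, h, rfl⟩⟩
  rintro ⟨ν, hν, e⟩
  rwa [show piQF (matType X) = ν from Subtype.ext e.symm]

/-! ### Orbital covering numbers and growth rates -/

theorem orbNhd_mono {n : ℕ} (F : Finset ℕ) (ε : ℝ) {Ω Ω' : Set (ℕ → Mat n)} (h : Ω ⊆ Ω') :
    orbNhd F ε Ω ⊆ orbNhd F ε Ω' := by
  rintro Y ⟨U, hU, X, hX, hY⟩
  exact ⟨U, hU, X, h hX, hY⟩

theorem orbCovering_le {n : ℕ} {F : Finset ℕ} {ε : ℝ} {Ω Ω' : Set (ℕ → Mat n)}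
    (h : Ω ⊆ orbNhd F ε Ω') : orbCovering F ε Ω ≤ Ω'.encard :=
  iInf₂_le Ω' h

theorem orbCovering_mono {n : ℕ} (F : Finset ℕ) (ε : ℝ) {Ω Ω' : Set (ℕ → Mat n)} (h : Ω ⊆ Ω') :
    orbCovering F ε Ω ≤ orbCovering F ε Ω' :=
  le_iInf₂ fun _ hA => orbCovering_le (h.trans hA)

theorem orbCovering_empty {n : ℕ} (F : Finset ℕ) (ε : ℝ) :
    orbCovering F ε (∅ : Set (ℕ → Mat n)) = 0 :=
  le_antisymm ((orbCovering_le (Set.empty_subset _)).trans_eq Set.encard_empty) zero_le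

theorem orbCovering_union_le {n : ℕ} (F : Finset ℕ) (ε : ℝ) (Ω Ω' : Set (ℕ → Mat n)) :
    orbCovering F ε (Ω ∪ Ω') ≤ orbCovering F ε Ω + orbCovering F ε Ω' := by
  conv_rhs => rw [orbCovering, orbCovering, iInf_subtype', iInf_subtype']
  rw [ENat.iInf_add]
  refine le_iInf fun A => ?_
  rw [ENat.add_iInf]
  refine le_iInf fun A' => ?_
  refine (orbCovering_le ?_).trans (Set.encard_union_le A.1 A'.1)
  exact Set.union_subset (A.2.trans (orbNhd_mono F ε Set.subset_union_left))
    (A'.2.trans (orbNhd_mono F ε Set.subset_union_right))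

theorem microstates_union {Φ : Set Ltr.Formula} (r : ℕ → Radius) (n : ℕ)
    (K K' : Set (TypeSpace Φ Ttr)) :
    microstates r n (K ∪ K') = microstates r n K ∪ microstates r n K' := by
  ext X
  simp only [microstates, Set.mem_ofPred_eq, Set.mem_union, or_and_right, exists_or, and_or_left]

theorem microstates_empty {Φ : Set Ltr.Formula} (r : ℕ → Radius) (n : ℕ) :
    microstates r n (∅ : Set (TypeSpace Φ Ttr)) = ∅ := by
  simp [microstates]

theorem Ultrafilter.tendsto_limUnder_of_compactSpace {I X : Type*} [TopologicalSpace X]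
    [CompactSpace X] [Nonempty X] (V : Ultrafilter I) (f : I → X) :
    Tendsto f V (𝓝 (limUnder (V : Filter I) f)) := by
  obtain ⟨x, -, hx⟩ := (isCompact_univ (X := X)).ultrafilter_le_nhds (V.map f) (by simp)
  exact tendsto_nhds_limUnder ⟨x, hx⟩

/-- The quantity `(1/n²) log K_{F,ε}^{orb}(Γ_r^{(n)}(O))`. -/
noncomputable def logCovering {Φ : Set Ltr.Formula} (r : ℕ → Radius) (F : Finset ℕ) (ε : ℝ)
    (O : Set (TypeSpace Φ Ttr)) (n : ℕ) : EReal :=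
  ((1 / (n : ℝ) ^ 2 : ℝ) : EReal) * ENNReal.log (orbCovering F ε (microstates r n O) : ENNReal)

theorem tendsto_growthRate {Φ : Set Ltr.Formula} (𝒰 : Ultrafilter ℕ) (r : ℕ → Radius)
    (F : Finset ℕ) (ε : ℝ) (O : Set (TypeSpace Φ Ttr)) :
    Tendsto (logCovering r F ε O) 𝒰 (𝓝 (growthRate 𝒰 r F ε O)) :=
  𝒰.tendsto_limUnder_of_compactSpace _

theorem one_div_sq_nonneg (n : ℕ) : (0 : EReal) ≤ ((1 / (n : ℝ) ^ 2 : ℝ) : EReal) :=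
  EReal.coe_nonneg.2 (by positivity)

theorem logCovering_mono {Φ Ψ : Set Ltr.Formula} {r : ℕ → Radius} (F : Finset ℕ) (ε : ℝ)
    {O : Set (TypeSpace Φ Ttr)} {O' : Set (TypeSpace Ψ Ttr)} {n : ℕ}
    (h : microstates r n O ⊆ microstates r n O') :
    logCovering r F ε O n ≤ logCovering r F ε O' n :=
  mul_le_mul_of_nonneg_left (ENNReal.log_monotone (ENat.toENNReal_mono (orbCovering_mono F ε h)))
    (one_div_sq_nonneg n)

/-- A sum is at most twice the maximum; the factor two contributes `(1/n²) log 2`, which vanishes in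
the limit. -/
theorem logCovering_union_le {Φ : Set Ltr.Formula} (r : ℕ → Radius) (F : Finset ℕ) (ε : ℝ)
    (O O' : Set (TypeSpace Φ Ttr)) (n : ℕ) :
    logCovering r F ε (O ∪ O') n ≤ ((1 / (n : ℝ) ^ 2 * Real.log 2 : ℝ) : EReal) +
      max (logCovering r F ε O n) (logCovering r F ε O' n) := by
  have hm : Monotone fun x : ENNReal => ((1 / (n : ℝ) ^ 2 : ℝ) : EReal) * ENNReal.log x :=
    fun x y h => mul_le_mul_of_nonneg_left (ENNReal.log_monotone h) (one_div_sq_nonneg n)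
  rw [logCovering, logCovering, logCovering, ← hm.map_max, microstates_union]
  have h2 : ENNReal.log 2 = ((Real.log 2 : ℝ) : EReal) := by
    simpa using ENNReal.log_ofReal_of_pos (x := 2) two_pos
  rw [EReal.coe_mul, ← h2, ← EReal.left_distrib_of_nonneg_of_ne_top (one_div_sq_nonneg n)
    (EReal.coe_ne_top _), ← ENNReal.log_mul_add]
  refine hm ?_
  refine (ENat.toENNReal_mono (orbCovering_union_le F ε _ _)).trans ?_
  rw [ENat.toENNReal_add, two_mul]
  exact add_le_add (le_max_left _ _) (le_max_right _ _)

theorem Ultrafilter.le_atTop_of_ne_pure {𝒰 : Ultrafilter ℕ} (h𝒰 : ∀ n : ℕ, 𝒰 ≠ pure n) :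
    (𝒰 : Filter ℕ) ≤ atTop := by
  rw [← Nat.cofinite_eq_atTop]
  rcases 𝒰.le_cofinite_or_eq_pure with h | ⟨n, h⟩
  · exact h
  · exact absurd h (h𝒰 n)

theorem growthRate_mono {𝒰 : Ultrafilter ℕ} (h𝒰 : ∀ n : ℕ, 𝒰 ≠ pure n)
    {Φ Ψ : Set Ltr.Formula} {r : ℕ → Radius} (F : Finset ℕ) (ε : ℝ)
    {O : Set (TypeSpace Φ Ttr)} {O' : Set (TypeSpace Ψ Ttr)}
    (h : ∀ (n : ℕ) [NeZero n], microstates r n O ⊆ microstates r n O') :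
    growthRate 𝒰 r F ε O ≤ growthRate 𝒰 r F ε O' := by
  refine le_of_tendsto_of_tendsto (tendsto_growthRate 𝒰 r F ε O) (tendsto_growthRate 𝒰 r F ε O') ?_
  -- The degenerate algebra `M_0(ℂ)` is not tracial; a non-principal ultrafilter ignores `n = 0`.
  filter_upwards [Ultrafilter.le_atTop_of_ne_pure h𝒰 (eventually_ne_atTop 0)] with n hn
  have : NeZero n := ⟨hn⟩
  exact logCovering_mono F ε (h n)

theorem growthRate_empty {𝒰 : Ultrafilter ℕ} (h𝒰 : ∀ n : ℕ, 𝒰 ≠ pure n)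
    {Φ : Set Ltr.Formula} (r : ℕ → Radius) (F : Finset ℕ) (ε : ℝ) :
    growthRate 𝒰 r F ε (∅ : Set (TypeSpace Φ Ttr)) = ⊥ := by
  refine tendsto_nhds_unique (tendsto_growthRate 𝒰 r F ε _) (tendsto_const_nhds.congr' ?_)
  filter_upwards [Ultrafilter.le_atTop_of_ne_pure h𝒰 (eventually_ne_atTop 0)] with n hn
  -- At `n = 0` the product would be `0 * ⊥ = 0`, so positivity of `1/n²` matters.
  rw [logCovering, microstates_empty, orbCovering_empty, ENat.toENNReal_zero, ENNReal.log_zero,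
    EReal.coe_mul_bot_of_pos (by positivity)]

theorem growthRate_union_le {𝒰 : Ultrafilter ℕ} (h𝒰 : ∀ n : ℕ, 𝒰 ≠ pure n)
    {Φ : Set Ltr.Formula} (r : ℕ → Radius) (F : Finset ℕ) (ε : ℝ)
    (O O' : Set (TypeSpace Φ Ttr)) : growthRate 𝒰 r F ε (O ∪ O') ≤
      max (growthRate 𝒰 r F ε O) (growthRate 𝒰 r F ε O') := by
  have h0 : Tendsto (fun n : ℕ => ((1 / (n : ℝ) ^ 2 * Real.log 2 : ℝ) : EReal)) 𝒰
      (𝓝 ((0 : ℝ) : EReal)) := by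
    refine (continuous_coe_real_ereal.tendsto 0).comp ?_
    have h1 : Tendsto (fun n : ℕ => 1 / (n : ℝ) ^ 2) atTop (𝓝 0) := by
      simpa using (tendsto_one_div_atTop_nhds_zero_nat (𝕜 := ℝ)).pow 2
    simpa using (h1.mono_left (Ultrafilter.le_atTop_of_ne_pure h𝒰)).mul_const (Real.log 2)
  have h2 := (tendsto_growthRate 𝒰 r F ε O).max (tendsto_growthRate 𝒰 r F ε O')
  -- Addition on the extended reals is continuous here because the first limit is finite.
  have h3 := (EReal.continuousAt_add (p := (((0 : ℝ) : EReal),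
    max (growthRate 𝒰 r F ε O) (growthRate 𝒰 r F ε O'))) (.inl (EReal.coe_ne_top 0))
    (.inl (EReal.coe_ne_bot 0))).tendsto.comp (h0.prodMk_nhds h2)
  simp only [EReal.coe_zero, zero_add] at h3
  exact le_of_tendsto_of_tendsto' (tendsto_growthRate 𝒰 r F ε _) h3
    (logCovering_union_le r F ε O O')

/-- The condition `⊥ < c` covers the empty union, whose growth rate is `⊥`. -/
theorem growthRate_biUnion_lt {𝒰 : Ultrafilter ℕ} (h𝒰 : ∀ n : ℕ, 𝒰 ≠ pure n)
    {Φ : Set Ltr.Formula} (r : ℕ → Radius) (F : Finset ℕ) (ε : ℝ)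
    {J : Type*} (t : Finset J) (O : J → Set (TypeSpace Φ Ttr)) {c : EReal} (hc : ⊥ < c)
    (h : ∀ j ∈ t, growthRate 𝒰 r F ε (O j) < c) :
    growthRate 𝒰 r F ε (⋃ j ∈ t, O j) < c := by
  classical
  induction t using Finset.induction_on with
  | empty => simpa [growthRate_empty h𝒰] using hc
  | insert j t hj ih =>
    rw [Finset.set_biUnion_insert]
    exact (growthRate_union_le h𝒰 r F ε _ _).trans_lt (max_lt (h j (Finset.mem_insert_self j t))
      (ih fun k hk => h k (Finset.mem_insert_of_mem hk)))

/-! ### Variational principle and restriction to quantifier-free types -/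

/-- The variational principle: the covering entropy of a closed set of types is the supremum of the
entropies of its elements. -/
theorem Ent_eq_iSup {𝒰 : Ultrafilter ℕ} (h𝒰 : ∀ n : ℕ, 𝒰 ≠ pure n)
    {K : Set FullType} (hK : IsClosed K) : Ent 𝒰 K = ⨆ ν ∈ K, Ent 𝒰 {ν} := by
  refine le_antisymm ?_ (iSup₂_le fun ν hν => ?_)
  · refine iSup_le fun r => iSup_le fun F => iSup₂_le fun ε hε => le_of_forall_gt_imp_ge_of_dense
      fun c hc => ?_
    -- Here `c` is an arbitrary value above the supremum, so the infimum over neighbourhoods of each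
    -- `ν` is already below `c` at some open set.
    have hO : ∀ ν ∈ K, ∃ O : Set FullType, IsOpen O ∧ ν ∈ O ∧ growthRate 𝒰 r F ε O < c := by
      intro ν hν
      have h1 : entAt 𝒰 r F ε {ν} < c := lt_of_le_of_lt
        (((le_iSup₂ (f := fun ε (_ : 0 < ε) => entAt 𝒰 r F ε {ν}) ε hε).trans
          (le_iSup (fun F => ⨆ (ε : ℝ) (_ : 0 < ε), entAt 𝒰 r F ε {ν}) F)).trans
          ((le_iSup (fun r => ⨆ (F : Finset ℕ) (ε : ℝ) (_ : 0 < ε), entAt 𝒰 r F ε {ν}) r).trans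
          (le_iSup₂ (f := fun ν (_ : ν ∈ K) => Ent 𝒰 {ν}) ν hν))) hc
      simp only [entAt, iInf_lt_iff] at h1
      obtain ⟨O, hO, hν, h⟩ := h1
      exact ⟨O, hO, hν rfl, h⟩
    choose! O hO hνO hlt using hO
    obtain ⟨t, ht, hcov⟩ := ((isCompact_matLimits r).inter_right hK).elim_nhds_subcover O
      fun ν hν => (hO ν hν.2).mem_nhds (hνO ν hν.2)
    -- The finite union covers only the part of `K` inside `matLimits r`. The open complement of
    -- `matLimits r` takes in the rest and contributes no microstates.
    have hopen : IsOpen ((⋃ ν ∈ t, O ν) ∪ (matLimits r)ᶜ) :=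
      (isOpen_biUnion fun ν hν => hO ν (ht ν hν).2).union
        (isCompact_matLimits r).isClosed.isOpen_compl
    have hsub : K ⊆ (⋃ ν ∈ t, O ν) ∪ (matLimits r)ᶜ := fun ν hν => by
      by_cases h : ν ∈ matLimits r
      · exact Or.inl (hcov ⟨h, hν⟩)
      · exact Or.inr h
    refine (iInf₂_le_of_le _ hopen (iInf_le _ hsub)).trans (le_trans ?_
      (growthRate_biUnion_lt h𝒰 r F ε t O (bot_le.trans_lt hc) fun ν hν =>
        hlt ν (ht ν hν).2).le)
    refine growthRate_mono h𝒰 F ε fun n _ X hX => ?_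
    rw [mem_microstates_iff] at hX ⊢
    exact ⟨hX.1, hX.2.resolve_right fun h => h (matType_mem_matLimits hX.1)⟩
  · refine iSup_mono fun r => iSup_mono fun F => iSup₂_mono fun ε _ => ?_
    exact le_iInf₂ fun O hO => le_iInf fun h =>
      iInf₂_le_of_le O hO (iInf_le _ (Set.singleton_subset_iff.2 (h hν)))

/-- The quantifier-free covering entropy of a set is the covering entropy of its preimage. -/
theorem EntQF_eq_Ent_preimage {𝒰 : Ultrafilter ℕ} (h𝒰 : ∀ n : ℕ, 𝒰 ≠ pure n)
    (K : Set QFType) : EntQF 𝒰 K = Ent 𝒰 (piQF ⁻¹' K) := by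
  have hπ : Continuous piQF := TypeSpace.continuous_restrict _ _
  refine iSup_congr fun r => iSup_congr fun F => iSup_congr fun ε =>
    iSup_congr fun _ => le_antisymm ?_ ?_
  · refine le_iInf₂ fun O hO => le_iInf fun h => ?_
    -- The laws all of whose lifts in `matLimits r` lie in `O`.
    have hopen : IsOpen (piQF '' (matLimits r \ O))ᶜ :=
      (((isCompact_matLimits r).diff hO).image hπ).isClosed.isOpen_compl
    have hsub : K ⊆ (piQF '' (matLimits r \ O))ᶜ := by
      rintro _ hμ ⟨ν, hν, rfl⟩
      exact hν.2 (h hμ)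
    refine (iInf₂_le_of_le _ hopen (iInf_le _ hsub)).trans
      (growthRate_mono h𝒰 F ε fun n _ X hX => ?_)
    rw [mem_microstates_qf_iff] at hX
    rw [mem_microstates_iff]
    refine ⟨hX.1, ?_⟩
    by_contra hXO
    exact hX.2 ⟨_, ⟨matType_mem_matLimits hX.1, hXO⟩, rfl⟩
  · refine le_iInf₂ fun O hO => le_iInf fun h => ?_
    refine (iInf₂_le_of_le _ (hO.preimage hπ) (iInf_le _ (Set.preimage_mono h))).trans
      (growthRate_mono h𝒰 F ε fun n _ X hX => ?_)
    rw [mem_microstates_iff] at hX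
    exact mem_microstates_qf_iff.2 hX

theorem mainTheorem5 (𝒰 : Ultrafilter ℕ) (h𝒰 : ∀ n : ℕ, 𝒰 ≠ pure n) :
    (∀ μ : QFType, EntQF 𝒰 {μ} = ⨆ ν ∈ piQF ⁻¹' {μ}, Ent 𝒰 {ν}) ∧
    (∀ K : Set QFType, IsClosed K → EntQF 𝒰 K = Ent 𝒰 (piQF ⁻¹' K)) := by
  have hπ : Continuous piQF := TypeSpace.continuous_restrict _ _
  refine ⟨fun μ => ?_, fun K _ => EntQF_eq_Ent_preimage h𝒰 K⟩
  -- The fibre is closed because laws form a Hausdorff space.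
  rw [EntQF_eq_Ent_preimage h𝒰, Ent_eq_iSup h𝒰 (isClosed_singleton.preimage hπ)]
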